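/- Let $0<p<1$ and $q=1-p$. For a finite binary string $\alpha=\alpha_1\cdots\alpha_k$ let $P(\alpha)=\prod_{i=1}^k P(\alpha_i)$, where $P(1)=p$ and $P(0)=q$. For $R>1$, the Khodak code with threshold $r=1/R$ is the finite set of phrases (its dictionary) consisting of the nonempty strings $\alpha$ such that $P(\alpha)<r$ while the parent $\alpha'$ ($\alpha$ without its last letter) has $P(\alpha')\ge r$; these are the external nodes of the binary tree whose internal nodes are the strings with $P(\alpha)\ge r$. Let $M(R)$ be the number of phrases. Let $$H=-p\ln p-q\ln q,\qquad H_2=p\ln^2p+q\ln^2q,\qquad \sigma^2=H_2-H^2=pq\ln^2(p/q).$$ When $\ln p/\ln q$ is rational, let $d=\gcd(\ln p,\ln q)$ be the largest positive real number such that $\ln p$ and $\ln q$ are both integer multiples of $d$. Write $\{x\}=x-\lfloor x\rfloor$. **(A) Number of phrases.** As $R\to\infty$: (i) if $\ln p/\ln q$ is irrational, then $M(R)/R\to 1/H$; (ii) if $\ln p/\ln q$ is rational, then $$\frac{M(R)}{R}=\frac1H\cdot\frac{d}{1-e^{-d}}\,e^{-d\{(\ln R)/d\}}+o(1).$$ **(B)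 Length of a random phrase.** Let $\Xi=\xi_1\xi_2\cdots$ be a random infinite string with i.i.d. letters, $\mathbb P(\xi_i=1)=p$, $\mathbb P(\xi_i=0)=q$, and let $D_R$ be the length of the unique prefix of $\Xi$ that belongs to the Khodak dictionary with threshold $1/R$. With $S_n=-\sum_{i=1}^n\ln P(\xi_i)$ and $\nu(t)=\min\{n:S_n>t\}$, we have $D_R=\nu(\ln R)$ for every $R>1$, and $D_R$ has a finite second moment. As $R\to\infty$: (i) $D_R/\ln R\to 1/H$ almost surely; (ii) $\dfrac{D_R-H^{-1}\ln R}{\sqrt{\ln R}}\to N\bigl(0,\sigma^2/H^3\bigr)$ in distribution (for $p=1/2$ the limit is the constant $0$); if $p\ne1/2$, then $\sigma^2>0$ and $\dfrac{D_R-H^{-1}\ln R}{\sqrt{(\sigma^2/H^3)\ln R}}\to N(0,1)$ in distribution; (iii) $\operatorname{Var}D_R\sim\dfrac{\sigma^2}{H^3}\ln R$ (for $p=1/2$ this means that $\operatorname{Var}D_R=0$ for all large $R$); (iv) if $\ln p/\ln q$ is irrational, then $\mathbb E D_R=\dfrac{\ln R}{H}+\dfrac{H_2}{2H^2}+o(1)$;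 (v) if $\ln p/\ln q$ is rational, then $$\mathbb E D_R=\frac{\ln R}{H}+\frac{H_2}{2H^2}+\frac dH\Bigl(\frac12-\Bigl\{\frac{\ln R}{d}\Bigr\}\Bigr)+o(1).$$ -/

import Mathlib

open MeasureTheory ProbabilityTheory Filter Topology Asymptotics

namespace Khodak

/-- Probability of a single letter (`true` is the letter 1, of probability `p`,
and `false` is the letter 0, of probability `1 - p`). -/
noncomputable def letterProb (p : ℝ) (b : Bool) : ℝ := if b then p else 1 - p

/-- Probability `P(α)` of a finite string: the product of the letter probabilities. -/
noncomputable def stringProb (p : ℝ) (α : List Bool) : ℝ := (α.map (letterProb p)).prod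

/-- The Khodak dictionary with threshold `r`. The internal nodes of the parsing tree are the
strings `β` with `r ≤ P(β)`; the phrases are the external nodes, that is, the strings with
probability `< r` whose parent (the string without its last letter) is internal. -/
def phrases (p r : ℝ) : Set (List Bool) :=
  {α | stringProb p α < r ∧ ∃ (β : List Bool) (b : Bool), α = β ++ [b] ∧ r ≤ stringProb p β}

/-- `M(R)`: the number of phrases of the Khodak code with threshold `1 / R`. -/
noncomputable def numPhrases (p R : ℝ) : ℕ := (phrases p (1 / R)).ncard

/-- The prefix of length `n` of an infinite string. -/
def pre (s : ℕ → Bool) (n : ℕ) : List Bool := (List.range n).map s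

/-- The length of the first phrase, in the Khodak code with threshold `1 / R`, of the infinite
string `s`, that is, of the unique prefix of `s` that belongs to the dictionary. -/
noncomputable def phraseLength (p R : ℝ) (s : ℕ → Bool) : ℕ :=
  sInf {n | pre s n ∈ phrases p (1 / R)}

/-- `S_n = X_1 + ⋯ + X_n` with `X_i = - ln P(ξ_i)`; the letters of `s` are numbered from 0. -/
noncomputable def partialSum (p : ℝ) (s : ℕ → Bool) (n : ℕ) : ℝ :=
  ∑ i ∈ Finset.range n, -Real.log (letterProb p (s i))

/-- `ν(t) = min {n : S_n > t}`. -/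
noncomputable def nu (p t : ℝ) (s : ℕ → Bool) : ℕ := sInf {n | t < partialSum p s n}

/-- `H₂ = p ln² p + q ln² q`. -/
noncomputable def secondMoment (p : ℝ) : ℝ :=
  p * Real.log p ^ 2 + (1 - p) * Real.log (1 - p) ^ 2

/-- `σ² = H₂ - H²`; here `H` is `Real.binEntropy p = - p ln p - q ln q`. -/
noncomputable def sigmaSq (p : ℝ) : ℝ := secondMoment p - Real.binEntropy p ^ 2

/-- The positive reals of which both `x` and `y` are integer multiples. -/
def commonDivisors (x y : ℝ) : Set ℝ := {d | 0 < d ∧ ∃ m n : ℤ, x = m * d ∧ y = n * d}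

/-- `gcd(x, y)`: the largest positive real `d` such that `x` and `y` are integer multiples
of `d` (see `isGreatest_realGcd`). -/
noncomputable def realGcd (x y : ℝ) : ℝ := sSup (commonDivisors x y)

theorem isGreatest_realGcd {x y : ℝ} (hx : x ≠ 0) (hy : y ≠ 0)
    (h : ∃ c : ℚ, (c : ℝ) = x / y) : IsGreatest (commonDivisors x y) (realGcd x y) := by
  suffices H : ∃ d, IsGreatest (commonDivisors x y) d by
    obtain ⟨d, hd⟩ := H
    rw [realGcd, hd.csSup_eq]
    exact hd
  obtain ⟨c, hc⟩ := h
  have hden : (0 : ℝ) < c.den := by exact_mod_cast c.den_pos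
  have hxy : x * c.den = y * c.num := by
    have h2 : (c : ℝ) = c.num / c.den := by exact_mod_cast (Rat.num_div_den c).symm
    rw [h2] at hc
    field_simp at hc
    linarith
  have key : ∀ d ∈ commonDivisors x y, d ≤ |y| / c.den := by
    rintro d ⟨hd, m, n, rfl, rfl⟩
    have hn : n ≠ 0 := by rintro rfl; simp at hy
    have e : m * (c.den : ℤ) = n * c.num := by
      have : (m * c.den : ℝ) = n * c.num := by
        apply mul_right_cancel₀ hd.ne'
        linarith
      exact_mod_cast this
    have hdvd : (c.den : ℤ) ∣ n := by
      have hcop : IsCoprime (c.den : ℤ) c.num := by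
        rw [Int.isCoprime_iff_gcd_eq_one, Int.gcd_comm]
        exact c.reduced
      exact hcop.dvd_of_dvd_mul_right ⟨m, by linarith⟩
    have hle : (c.den : ℤ) ≤ |n| := Int.le_of_dvd (abs_pos.2 hn) ((dvd_abs _ _).2 hdvd)
    have hle' : (c.den : ℝ) ≤ |(n : ℝ)| := by exact_mod_cast hle
    rw [le_div_iff₀ hden, abs_mul, abs_of_pos hd, mul_comm]
    gcongr
  refine ⟨|y| / c.den, ⟨by positivity, ?_⟩, key⟩
  rcases abs_cases y with ⟨h1, _⟩ | ⟨h1, _⟩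
  · refine ⟨c.num, c.den, ?_, ?_⟩ <;> rw [h1] <;> field_simp <;> push_cast <;> linarith
  · refine ⟨-c.num, -c.den, ?_, ?_⟩ <;> rw [h1] <;> field_simp <;> push_cast <;> linarith

theorem stringProb_append (p : ℝ) (β : List Bool) (b : Bool) :
    stringProb p (β ++ [b]) = stringProb p β * letterProb p b := by
  simp [stringProb]

theorem pre_succ (s : ℕ → Bool) (n : ℕ) : pre s (n + 1) = pre s n ++ [s n] := by
  simp [pre, List.range_succ]

theorem stringProb_bounds {p : ℝ} (h0 : 0 < p) (h1 : p < 1) (α : List Bool) :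
    0 < stringProb p α ∧ stringProb p α ≤ max p (1 - p) ^ α.length := by
  induction α with
  | nil => simp [stringProb]
  | cons b α ih =>
    have hb : 0 < letterProb p b ∧ letterProb p b ≤ max p (1 - p) := by
      cases b <;> simp [letterProb, h0, h1]
    have e : stringProb p (b :: α) = letterProb p b * stringProb p α := by simp [stringProb]
    rw [e, List.length_cons, pow_succ']
    exact ⟨mul_pos hb.1 ih.1, mul_le_mul hb.2 ih.2 ih.1.le (hb.1.le.trans hb.2)⟩

theorem exists_bound {p r : ℝ} (h0 : 0 < p) (h1 : p < 1) (hr : 0 < r) :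
    ∃ n : ℕ, ∀ α : List Bool, r ≤ stringProb p α → α.length < n := by
  have hm : max p (1 - p) < 1 := by simp [h0, h1]
  have hm0 : 0 ≤ max p (1 - p) := le_max_of_le_left h0.le
  obtain ⟨n, hn⟩ := exists_pow_lt_of_lt_one hr hm
  refine ⟨n, fun α hα => ?_⟩
  by_contra! hlen
  have := (stringProb_bounds h0 h1 α).2.trans (pow_le_pow_of_le_one hm0 hm.le hlen)
  linarith

/-- The Khodak dictionary is finite. -/
theorem phrases_finite {p r : ℝ} (h0 : 0 < p) (h1 : p < 1) (hr : 0 < r) :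
    (phrases p r).Finite := by
  obtain ⟨n, hn⟩ := exists_bound h0 h1 hr
  refine (List.finite_length_le Bool n).subset ?_
  rintro α ⟨-, β, b, rfl, hβ⟩
  simpa using hn β hβ

/-- Every infinite string has exactly one prefix in the Khodak dictionary. -/
theorem existsUnique_prefix {p r : ℝ} (h0 : 0 < p) (h1 : p < 1) (hr : 0 < r) (hr1 : r < 1)
    (s : ℕ → Bool) : ∃! n, pre s n ∈ phrases p r := by
  classical
  have hanti : Antitone fun n => stringProb p (pre s n) := by
    refine antitone_nat_of_succ_le fun n => ?_
    rw [pre_succ, stringProb_append]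
    refine mul_le_of_le_one_right (stringProb_bounds h0 h1 _).1.le ?_
    cases s n <;> simp [letterProb, h0.le, h1.le]
  have hmem : ∀ n, pre s (n + 1) ∈ phrases p r ↔
      stringProb p (pre s (n + 1)) < r ∧ r ≤ stringProb p (pre s n) := by
    intro n
    refine and_congr_right fun _ => ⟨?_, fun h => ⟨_, _, pre_succ s n, h⟩⟩
    rintro ⟨β, b, hβ, h⟩
    rw [pre_succ] at hβ
    rwa [(List.append_inj' hβ rfl).1]
  have hex : ∃ n, stringProb p (pre s n) < r := by
    obtain ⟨n, hn⟩ := exists_bound h0 h1 hr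
    refine ⟨n, ?_⟩
    by_contra! h
    simpa [pre] using hn _ h
  have hzero : ¬ stringProb p (pre s 0) < r := by simpa [pre, stringProb] using hr1.le
  obtain ⟨k, hk⟩ : ∃ k, Nat.find hex = k + 1 :=
    Nat.exists_eq_succ_of_ne_zero fun h => hzero (h ▸ Nat.find_spec hex)
  refine ⟨k + 1, (hmem k).2 ⟨hk ▸ Nat.find_spec hex,
    not_lt.1 (Nat.find_min hex (hk ▸ Nat.lt_succ_self k))⟩, ?_⟩
  rintro (_ | j) hj
  · exact absurd hj.1 hzero
  · obtain ⟨hj1, hj2⟩ := (hmem j).1 hj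
    have hle : k + 1 ≤ j + 1 := hk ▸ Nat.find_min' hex hj1
    by_contra hne
    have : k + 1 ≤ j := by omega
    have h3 := hanti this
    have h4 : stringProb p (pre s (k + 1)) < r := hk ▸ Nat.find_spec hex
    simp only at h3
    linarith

end Khodak

/-! Write `t = log R`, `a = -log p`, `b = -log q`, with `q = 1 - p`. Splitting the parsing tree at
its root gives the leaf count `A` and the mean leaf depth `V` recursions for `t ≥ 0`: `A(t) = A(t-a)
+ A(t-b)` and `V(t) = 1 + p V(t-a) + q V(t-b)`. Hence `exp(-t) A(t)` and `H V(t) - t` are bounded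
solutions of the renewal equation `g(t) = p g(t-a) + q g(t-b)`.

Bounded solutions of this kind converge by an elementary argument (`exists_tendsto`). Where `g`
comes close to its limsup `L`, both terms of the average must do so too, and hence `g` is near `L`
at the translates by `i a + j b`. If these translates control a whole window of length `max a b`,
the lower bound passes to all later times. For irrational `a / b` they become dense far out, and `g`
cannot drop fast; in the lattice case, on functions constant on cells of length `d`, they hit every
cell. The limit is read off from a conserved quantity, `p ∫_{t-a}^t g + q ∫_{t-b}^t g` or its
discrete analogue, evaluated at `t = 0` (`limit_eq_integral`, `limit_of_lattice`).

The phrase length is the first passage time `ν(t)`, and `V(t) = E ν(t)` (`integral_nu`). The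
overshoot `S_ν - t` lies between 0 and the largest step, so `H ν - t` differs from minus the stopped
centered walk by a bounded amount. The strong law follows from that of `S_n`. Wald's second identity
(`integral_transform_sq`) gives `E (S_ν - H ν)² = σ² E ν`, and from it the variance. The same
identity gives `σ² E|ν - n|` for the squared distance of the centered walk at times `ν` and `n`.
With `n = ⌊t / H⌋` this is `O(√t)`, so that the central limit theorem carries over from time `n` to
time `ν`. -/

namespace Khodak

/-! ### Bounded solutions of the renewal equation and their limits -/

/-- Induction along the half-line in steps of length at least `δ`. -/
theorem renewal_induction {δ : ℝ} (hδ : 0 < δ) {P : ℝ → Prop} (h0 : ∀ t < 0, P t)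
    (h : ∀ t, 0 ≤ t → (∀ s ≤ t - δ, P s) → P t) (t : ℝ) : P t := by
  have key : ∀ n : ℕ, ∀ t < n * δ, P t := by
    intro n
    induction n with
    | zero => simpa using h0
    | succ n ih =>
      intro t ht
      rcases lt_or_ge t 0 with h1 | h1
      · exact h0 t h1
      · refine h t h1 fun s hs => ih s ?_
        push_cast at ht
        linarith
  obtain ⟨n, hn⟩ := exists_nat_gt (t / δ)
  exact key n t ((div_lt_iff₀ hδ).1 hn)

/-- Bounded solutions of the renewal equation `g t = p g (t - a) + q g (t - b)` for `t ≥ 0`. -/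
structure RenewalSolution (a b p q : ℝ) (g : ℝ → ℝ) : Prop where
  ha : 0 < a
  hb : 0 < b
  hp : 0 < p
  hq : 0 < q
  hpq : p + q = 1
  eq : ∀ t, 0 ≤ t → g t = p * g (t - a) + q * g (t - b)
  bdd : ∃ K, ∀ t, -max a b ≤ t → |g t| ≤ K

/-- For `t ≥ 0` the equation averages earlier values, none taken to the left of `-max a b`, so a
bound on the initial window persists. -/
theorem bounded_of_renewal {a b p q : ℝ} {g : ℝ → ℝ} (ha : 0 < a) (hb : 0 < b)
    (hp : 0 < p) (hq : 0 < q) (hpq : p + q = 1)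
    (heq : ∀ t, 0 ≤ t → g t = p * g (t - a) + q * g (t - b)) {K : ℝ}
    (hK : ∀ t, -max a b ≤ t → t < 0 → |g t| ≤ K) (t : ℝ) : -max a b ≤ t → |g t| ≤ K := by
  refine renewal_induction (lt_min ha hb) (P := fun t => -max a b ≤ t → |g t| ≤ K)
    (fun t ht h => hK t h ht) (fun t ht ih _ => ?_) t
  have h1 := abs_le.1 (ih (t - a) (by linarith [min_le_left a b]) (by linarith [le_max_left a b]))
  have h2 := abs_le.1 (ih (t - b) (by linarith [min_le_right a b]) (by linarith [le_max_right a b]))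
  rw [heq t ht, abs_le]
  have e : q = 1 - p := by linarith
  subst e
  constructor <;> nlinarith

namespace RenewalSolution

variable {a b p q : ℝ} {g : ℝ → ℝ}

/-- A lower bound on a window of length `max a b` propagates to the right. -/
theorem le_of_window (h : RenewalSolution a b p q g) {m T : ℝ} (hT : 0 ≤ T)
    (hm : ∀ t, T - max a b ≤ t → t < T → m ≤ g t) (t : ℝ) (ht : T - max a b ≤ t) : m ≤ g t := by
  have key := renewal_induction (lt_min h.ha h.hb)
    (P := fun s => -max a b ≤ s → m ≤ g (s + T))
    (fun s hs hs' => hm _ (by linarith) (by linarith)) (fun s hs ih _ => ?_) (t - T) (by linarith)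
  · simpa using key
  · have h1 := ih (s - a) (by linarith [min_le_left a b]) (by linarith [le_max_left a b])
    have h2 := ih (s - b) (by linarith [min_le_right a b]) (by linarith [le_max_right a b])
    rw [h.eq _ (by linarith)]
    rw [show s + T - a = s - a + T by ring, show s + T - b = s - b + T by ring]
    have := mul_le_mul_of_nonneg_left h1 h.hp.le
    have := mul_le_mul_of_nonneg_left h2 h.hq.le
    have e := h.hpq
    have : m = p * m + q * m := by rw [← add_mul, e, one_mul]
    linarith

theorem symm (h : RenewalSolution a b p q g) : RenewalSolution b a q p g where
  ha := h.hb
  hb := h.ha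
  hp := h.hq
  hq := h.hp
  hpq := by rw [add_comm, h.hpq]
  eq t ht := by rw [h.eq t ht, add_comm]
  bdd := by rw [max_comm]; exact h.bdd

/-- If `L` bounds `g` asymptotically and is attained along `F`, then it is attained along the
translate of `F` by a step. -/
theorem tendsto_shift (h : RenewalSolution a b p q g) {L : ℝ}
    (hL : ∀ ε > 0, ∀ᶠ t in atTop, g t < L + ε) {F : Filter ℝ} {u : ℝ → ℝ}
    (hu : Tendsto u F atTop) (hg : Tendsto (fun t => g (u t)) F (𝓝 L)) :
    Tendsto (fun t => g (u t - a)) F (𝓝 L) := by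
  have hp := h.hp
  have hq := h.hq
  have shift : ∀ (x : ℝ), ∀ ε > 0, ∀ᶠ t in F, g (u t - x) < L + ε := fun x ε hε =>
    (tendsto_atTop_add_const_right F (-x) hu).eventually (hL ε hε)
  rw [Metric.tendsto_nhds]
  intro ε hε
  -- If `g (u t - a) ≤ L - ε`, the average would be at most `L - p ε + q (p ε / 2)`, which is below
  -- `L - p ε / 2`; hence this tolerance at `u t` and at `u t - b`.
  have h1 := (Metric.tendsto_nhds.1 hg) (p * ε / 2) (by positivity)
  filter_upwards [h1, shift a ε hε, shift b (p * ε / 2) (by positivity),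
    hu.eventually (eventually_ge_atTop 0)] with t h1 h2 h3 h4
  rw [Real.dist_eq, abs_lt] at h1 ⊢
  refine ⟨?_, by linarith⟩
  have e := h.eq _ h4
  rw [e] at h1
  have e2 : q = 1 - p := by linarith [h.hpq]
  subst e2
  have : (1 - p) * g (u t - b) ≤ (1 - p) * (L + p * ε / 2) := by gcongr
  have h5 : 0 < p * (p * ε / 2) := by positivity
  have : p * (L - ε) < p * g (u t - a) := by nlinarith
  have := lt_of_mul_lt_mul_left this hp.le
  linarith

theorem tendsto_shift_nat (h : RenewalSolution a b p q g) {L : ℝ}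
    (hL : ∀ ε > 0, ∀ᶠ t in atTop, g t < L + ε) {F : Filter ℝ} {u : ℝ → ℝ}
    (hu : Tendsto u F atTop) (hg : Tendsto (fun t => g (u t)) F (𝓝 L)) (i : ℕ) :
    Tendsto (fun t => g (u t - i * a)) F (𝓝 L) := by
  induction i with
  | zero => simpa using hg
  | succ i ih =>
    have := h.tendsto_shift hL (tendsto_atTop_add_const_right F (-(i * a)) hu) ih
    convert this using 3
    push_cast
    ring

/-- The hypothesis bounds `g` below, up to `ε`, on a whole window by its values at finitely many
translates `t - i a - j b`. At times where `g` nears its limsup those values are near it as well, so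
the window lies above `L - ε / 2`, and so does everything to its right. -/
theorem exists_tendsto (h : RenewalSolution a b p q g)
    (hd : ∀ ε > 0, ∃ (N : ℕ) (T T' : ℝ), ∀ t ≥ T', ∀ τ, T ≤ τ → τ ≤ T + max a b →
      ∃ i ≤ N, ∃ j ≤ N, g (t - i * a - j * b) - ε ≤ g (t - τ)) :
    ∃ L, Tendsto g atTop (𝓝 L) := by
  obtain ⟨K, hK⟩ := h.bdd
  have hev : ∀ᶠ t in atTop, |g t| ≤ K :=
    (eventually_ge_atTop (-max a b)).mono fun t ht => hK t ht
  have hb1 : IsBoundedUnder (· ≤ ·) atTop g :=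
    ⟨K, eventually_map.2 (hev.mono fun t ht => (abs_le.1 ht).2)⟩
  have hb2 : IsCoboundedUnder (· ≤ ·) atTop g :=
    IsBoundedUnder.isCoboundedUnder_le
      ⟨-K, eventually_map.2 (hev.mono fun t ht => (abs_le.1 ht).1)⟩
  set L := limsup g atTop with hLdef
  have hL : ∀ ε > 0, ∀ᶠ t in atTop, g t < L + ε := fun ε hε =>
    eventually_lt_of_limsup_lt (by linarith) hb1
  have hfreq : ∀ ε > 0, ∃ᶠ t in atTop, L - ε < g t := fun ε hε =>
    frequently_lt_of_lt_limsup hb2 (by linarith)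
  refine ⟨L, ?_⟩
  -- Times going to infinity along which `g` tends to its limsup; this filter takes the place of a
  -- sequence.
  let F : Filter ℝ := atTop ⊓ comap g (𝓝 L)
  have hF : F.NeBot := by
    rw [inf_neBot_iff_frequently_right]
    intro P hP
    obtain ⟨V, hV, hVP⟩ := mem_comap.1 hP
    obtain ⟨ε, hε, hball⟩ := Metric.mem_nhds_iff.1 hV
    refine ((hfreq ε hε).and_eventually (hL ε hε)).mono fun t ht => hVP (hball ?_)
    rw [Metric.mem_ball, Real.dist_eq, abs_lt]
    constructor <;> linarith [ht.1, ht.2]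
  have hFle : Tendsto (fun t : ℝ => t) F atTop := inf_le_left
  have hFg : Tendsto g F (𝓝 L) := (tendsto_comap).mono_left inf_le_right
  have hall : ∀ i j : ℕ, Tendsto (fun t => g (t - i * a - j * b)) F (𝓝 L) := fun i j =>
    h.symm.tendsto_shift_nat hL (tendsto_atTop_add_const_right F (-(i * a)) hFle)
      (h.tendsto_shift_nat hL hFle hFg i) j
  rw [Metric.tendsto_nhds]
  intro ε hε
  obtain ⟨N, T, T', hN⟩ := hd (ε / 4) (by positivity)
  -- The uniform bound `N` leaves finitely many pairs, so a single time `t` serves all of them.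
  have hev1 : ∀ᶠ t in F, ∀ i ∈ Finset.range (N + 1), ∀ j ∈ Finset.range (N + 1),
      L - ε / 4 < g (t - i * a - j * b) := by
    rw [eventually_all_finset]
    intro i _
    rw [eventually_all_finset]
    intro j _
    exact (hall i j).eventually (lt_mem_nhds (by linarith))
  obtain ⟨t, ht1, ht2, ht3⟩ := (hev1.and ((hFle.eventually (eventually_ge_atTop T')).and
    (hFle.eventually (eventually_ge_atTop T)))).exists
  have hlow : ∀ s ≥ t - T - max a b, L - ε / 2 ≤ g s := by
    intro s hs
    refine h.le_of_window (T := t - T) (by linarith) (fun s hs1 hs2 => ?_) s hs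
    obtain ⟨i, hi, j, hj, hij⟩ := hN t ht2 (t - s) (by linarith) (by linarith)
    have := ht1 i (Finset.mem_range_succ_iff.2 hi) j (Finset.mem_range_succ_iff.2 hj)
    rw [sub_sub_cancel] at hij
    linarith
  filter_upwards [eventually_ge_atTop (t - T - max a b), hL ε hε] with s hs1 hs2
  rw [Real.dist_eq, abs_lt]
  constructor <;> linarith [hlow s hs1]

end RenewalSolution

/-- If some integer combination of `a` and `b` equals `e > 0`, then the nonnegative integer
combinations meet every interval `[z, z + e]` far enough to the right. -/
theorem exists_nat_combination {a b e : ℝ} (ha : 0 < a) (hb : 0 < b) (he : 0 < e) {x y : ℤ}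
    (hxy : x * a + y * b = e) :
    ∃ T, 0 ≤ T ∧ ∀ z ≥ T, ∃ i j : ℕ, z ≤ i * a + j * b ∧ i * a + j * b < z + e := by
  obtain ⟨K, hK⟩ := exists_nat_ge (a / e)
  -- Start from `J a + J b`, add copies of `a` until `z` is less than `a` away, then add `e = x a +
  -- y b` at most `K + 1` times. The reserve `J` keeps both coefficients nonnegative even if `x` or
  -- `y` is negative.
  set J : ℕ := (K + 1) * max x.natAbs y.natAbs with hJ
  refine ⟨J * a + J * b, by positivity, fun z hz => ?_⟩
  set w := z - (J * a + J * b) with hw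
  have hw0 : 0 ≤ w := by simp only [hw]; linarith
  set i0 := ⌊w / a⌋₊ with hi0
  have h1 : i0 * a ≤ w := (le_div_iff₀ ha).1 (Nat.floor_le (by positivity))
  have h2 : w < (i0 + 1) * a := (div_lt_iff₀ ha).1 (Nat.lt_floor_add_one _)
  set k := ⌈(w - i0 * a) / e⌉₊ with hk
  have h3 : w - i0 * a ≤ k * e := (div_le_iff₀ he).1 (Nat.le_ceil _)
  have h4 : k * e < w - i0 * a + e := by
    have := Nat.ceil_lt_add_one (a := (w - i0 * a) / e) (div_nonneg (by linarith) he.le)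
    rw [← hk] at this
    have := mul_lt_mul_of_pos_right this he
    rwa [add_mul, div_mul_cancel₀ _ he.ne', one_mul] at this
  have hkK : k ≤ K + 1 := by
    have h5 : (w - i0 * a) / e ≤ K := le_trans (by gcongr; linarith) hK
    exact (Nat.ceil_le.2 h5).trans (Nat.le_succ _)
  have hbd : ∀ v : ℤ, v.natAbs ≤ max x.natAbs y.natAbs → 0 ≤ (J : ℤ) + k * v := by
    intro v hv
    have h6 : k * v.natAbs ≤ J := Nat.mul_le_mul hkK hv
    have h7 : ((k * v.natAbs : ℕ) : ℤ) ≤ J := by exact_mod_cast h6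
    push_cast at h7
    have h8 : -|v| ≤ v := neg_abs_le v
    nlinarith [Int.natCast_nonneg k]
  obtain ⟨i, hi⟩ := Int.eq_ofNat_of_zero_le (hbd x (le_max_left _ _))
  obtain ⟨j, hj⟩ := Int.eq_ofNat_of_zero_le (hbd y (le_max_right _ _))
  have hi' : (i : ℝ) = J + k * x := by exact_mod_cast hi.symm
  have hj' : (j : ℝ) = J + k * y := by exact_mod_cast hj.symm
  refine ⟨i0 + i, j, ?_⟩
  have e1 : ((i0 + i : ℕ) : ℝ) * a + j * b = i0 * a + (J * a + J * b) + k * e := by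
    push_cast
    rw [hi', hj', ← hxy]
    ring
  rw [e1]
  constructor <;> linarith

namespace RenewalSolution

variable {a b p q : ℝ} {g : ℝ → ℝ}

/-- The group generated by `a` and `b` is dense, so some combination `e > 0` is arbitrarily small,
and far out some `i a + j b` lies in `[τ, τ + e)`. Since `g t + K t` increases, `g` loses at most `K
e` from `t - i a - j b` to `t - τ`. -/
theorem exists_tendsto_of_irrational (h : RenewalSolution a b p q g) (hab : Irrational (a / b))
    {K : ℝ} (hK : 0 ≤ K)
    (hmono : ∀ s t, -max a b ≤ s → s ≤ t → g s + K * s ≤ g t + K * t) :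
    ∃ L, Tendsto g atTop (𝓝 L) := by
  have ha := h.ha
  have hb := h.hb
  refine h.exists_tendsto fun ε hε => ?_
  obtain ⟨e, heG, he0, he1⟩ := (dense_addSubgroupClosure_pair_iff.2 hab).exists_between
    (show (0 : ℝ) < ε / (K + 1) by positivity)
  obtain ⟨x, y, hxy⟩ := AddSubgroup.mem_closure_pair.1 heG
  simp only [zsmul_eq_mul] at hxy
  obtain ⟨T, hT0, hT⟩ := exists_nat_combination ha hb he0 hxy
  obtain ⟨N, hN⟩ := exists_nat_ge ((T + max a b + e) / min a b)
  have hN' := (div_le_iff₀ (lt_min ha hb)).1 hN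
  refine ⟨N, T, T + max a b + e, fun t ht τ h1 h2 => ?_⟩
  obtain ⟨i, j, hij1, hij2⟩ := hT τ h1
  have hcount : ∀ (k : ℕ) (x : ℝ), min a b ≤ x → k * x ≤ T + max a b + e → k ≤ N := by
    intro k x hx hk
    have h3 : (k : ℝ) * min a b ≤ N * min a b := (by gcongr : _ ≤ k * x).trans (hk.trans hN')
    exact_mod_cast le_of_mul_le_mul_right h3 (lt_min ha hb)
  have hi0 : 0 ≤ i * a := by positivity
  have hj0 : 0 ≤ j * b := by positivity
  refine ⟨i, hcount i a (min_le_left _ _) (by linarith), j,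
    hcount j b (min_le_right _ _) (by linarith), ?_⟩
  have h5 := hmono (t - i * a - j * b) (t - τ) (by linarith [le_max_left a b]) (by linarith)
  have h6 : K * e ≤ ε := by
    rw [lt_div_iff₀ (by positivity)] at he1
    nlinarith
  have h7 : K * (i * a + j * b - τ) ≤ K * e := by gcongr; linarith
  nlinarith

/-- By Bézout every large multiple of `d` is a nonnegative combination of `a` and `b`, so some
translate falls into the very cell of `t - τ`, where `g` takes the same value. -/
theorem exists_tendsto_of_lattice (h : RenewalSolution a b p q g) {d : ℝ} (hd : 0 < d) {m n : ℕ}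
    (ham : a = m * d) (hbn : b = n * d) (hmn : Nat.Coprime m n)
    (hg : ∀ t, g t = g (d * ⌊t / d⌋)) :
    ∃ L, Tendsto g atTop (𝓝 L) := by
  have ha := h.ha
  have hb := h.hb
  obtain ⟨T, hT0, hT⟩ := exists_nat_combination (x := m.gcdA n) (y := m.gcdB n) ha hb hd (by
    have := Nat.gcd_eq_gcd_ab m n
    rw [hmn] at this
    have h2 : (1 : ℝ) = m * m.gcdA n + n * m.gcdB n := by exact_mod_cast this
    rw [ham, hbn]
    linear_combination -d * h2)
  refine h.exists_tendsto fun ε hε => ?_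
  obtain ⟨N, hN⟩ := exists_nat_ge ((T + 2 * d + max a b) / min a b)
  have hN' := (div_le_iff₀ (lt_min ha hb)).1 hN
  -- Rounding costs at most one cell: `l * d ≥ τ - d`, so starting the window at `T + d` gives `l *
  -- d ≥ T`.
  refine ⟨N, T + d, 0, fun t _ τ h1 h2 => ?_⟩
  set l : ℤ := ⌊t / d⌋ - ⌊(t - τ) / d⌋ with hl
  have f1 := Int.floor_le (t / d)
  have f2 := Int.lt_floor_add_one (t / d)
  have f3 := Int.floor_le ((t - τ) / d)
  have f4 := Int.lt_floor_add_one ((t - τ) / d)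
  rw [le_div_iff₀ hd] at f1 f3
  rw [div_lt_iff₀ hd] at f2 f4
  have hl' : (l : ℝ) = ⌊t / d⌋ - ⌊(t - τ) / d⌋ := by push_cast [hl]; ring
  have hl1 : τ - d ≤ l * d := by rw [hl']; linarith
  have hl2 : l * d ≤ τ + d := by rw [hl']; linarith
  obtain ⟨i, j, hij1, hij2⟩ := hT (l * d) (by linarith)
  have hval : i * a + j * b = ((i * m + j * n : ℤ) : ℝ) * d := by
    rw [ham, hbn]; push_cast; ring
  -- The half-open interval `[l d, (l + 1) d)` contains only one multiple of `d`.
  have hlij : (i * m + j * n : ℤ) = l := by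
    rw [hval] at hij1 hij2
    have g1 : (l : ℝ) ≤ ((i * m + j * n : ℤ) : ℝ) := le_of_mul_le_mul_right hij1 hd
    have g2 : ((i * m + j * n : ℤ) : ℝ) < (l + 1 : ℤ) := by
      refine lt_of_mul_lt_mul_right (a := d) ?_ hd.le
      push_cast at hij2 ⊢
      linarith
    have g1' : l ≤ i * m + j * n := by exact_mod_cast g1
    have g2' : (i * m + j * n : ℤ) < l + 1 := by exact_mod_cast g2
    omega
  have hcount : ∀ (k : ℕ) (x : ℝ), min a b ≤ x → k * x ≤ T + 2 * d + max a b → k ≤ N := by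
    intro k x hx hk
    have h3 : (k : ℝ) * min a b ≤ N * min a b := (by gcongr : _ ≤ k * x).trans (hk.trans hN')
    exact_mod_cast le_of_mul_le_mul_right h3 (lt_min ha hb)
  have hi0 : 0 ≤ i * a := by positivity
  have hj0 : 0 ≤ j * b := by positivity
  rw [hlij] at hval
  refine ⟨i, hcount i a (min_le_left _ _) (by linarith), j,
    hcount j b (min_le_right _ _) (by linarith), ?_⟩
  have hfl : ⌊(t - i * a - j * b) / d⌋ = ⌊(t - τ) / d⌋ := by
    have : (t - i * a - j * b) / d = t / d - (l : ℤ) := by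
      rw [sub_sub, hval]; field_simp
    rw [this, Int.floor_sub_intCast]
    omega
  have : g (t - i * a - j * b) = g (t - τ) := by
    rw [hg (t - i * a - j * b), hg (t - τ), hfl]
  linarith

/-- The limit of a lattice solution, found from a conserved sum. -/
theorem limit_of_lattice (h : RenewalSolution a b p q g) {d : ℝ} (hd : 0 < d) {m n : ℕ}
    (ham : a = m * d) (hbn : b = n * d) {L : ℝ} (hL : Tendsto g atTop (𝓝 L)) :
    (p * m + q * n) * L = p * ∑ i ∈ Finset.range m, g (-((i + 1 : ℕ) * d)) +
      q * ∑ i ∈ Finset.range n, g (-((i + 1 : ℕ) * d)) := by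
  -- Passing from `k` to `k + 1` adds `(p + q) g(k d)` and removes `p g(k d - a) + q g(k d - b)`;
  -- these agree by the renewal equation.
  set C : ℕ → ℝ := fun k => p * ∑ i ∈ Finset.range m, g (k * d - ((i + 1 : ℕ) * d)) +
      q * ∑ i ∈ Finset.range n, g (k * d - ((i + 1 : ℕ) * d)) with hC
  have hsum : ∀ (k m : ℕ), ∑ i ∈ Finset.range m, g ((k + 1 : ℕ) * d - ((i + 1 : ℕ) * d)) =
      ∑ i ∈ Finset.range m, g (k * d - ((i + 1 : ℕ) * d)) + g (k * d) - g (k * d - m * d) := by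
    intro k m
    induction m with
    | zero => simp
    | succ m ih =>
      rw [Finset.sum_range_succ, Finset.sum_range_succ, ih]
      have : ((k + 1 : ℕ) : ℝ) * d - ((m + 1 : ℕ) * d) = k * d - m * d := by push_cast; ring
      rw [this]
      ring
  have hconst : ∀ k, C k = C 0 := by
    intro k
    induction k with
    | zero => rfl
    | succ k ih =>
      rw [← ih]
      simp only [hC, hsum]
      have := h.eq (k * d) (by positivity)
      rw [ham, hbn] at this
      have e : q = 1 - p := by linarith [h.hpq]
      rw [e] at this ⊢
      linear_combination this
  have hterm : ∀ i : ℕ, Tendsto (fun k : ℕ => g (k * d - ((i + 1 : ℕ) * d))) atTop (𝓝 L) := by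
    intro i
    refine hL.comp (tendsto_atTop_add_const_right _ _ ?_)
    exact tendsto_natCast_atTop_atTop.atTop_mul_const hd
  have hlim : Tendsto C atTop (𝓝 (p * ∑ i ∈ Finset.range m, L + q * ∑ i ∈ Finset.range n, L)) :=
    ((tendsto_finsetSum _ fun i _ => hterm i).const_mul p).add
      ((tendsto_finsetSum _ fun i _ => hterm i).const_mul q)
  have hlim2 : Tendsto C atTop (𝓝 (C 0)) := by
    rw [funext hconst]
    exact tendsto_const_nhds
  have := tendsto_nhds_unique hlim hlim2
  simp only [hC, Finset.sum_const, Finset.card_range, nsmul_eq_mul, Nat.cast_zero, zero_mul,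
    zero_sub] at this
  rw [← this]
  ring

/-- The limit of a solution, found from a conserved integral. -/
theorem limit_eq_integral (h : RenewalSolution a b p q g) {L : ℝ} (hL : Tendsto g atTop (𝓝 L))
    (hint : ∀ s t, -max a b ≤ s → s ≤ t → IntervalIntegrable g volume s t) :
    (p * a + q * b) * L = p * (∫ t in (-a)..0, g t) + q * ∫ t in (-b)..0, g t := by
  have ha := h.ha
  have hb := h.hb
  have hca := le_max_left a b
  have hcb := le_max_right a b
  have hint0 : ∀ t, -max a b ≤ t → IntervalIntegrable g volume 0 t := by
    intro t ht
    rcases le_total 0 t with h0 | h0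
    · exact hint 0 t (by linarith) h0
    · exact (hint t 0 ht h0).symm
  have hint' : ∀ s t, -max a b ≤ s → -max a b ≤ t → IntervalIntegrable g volume s t :=
    fun s t hs ht => (hint0 s hs).symm.trans (hint0 t ht)
  -- Formally `I' = g(t) - p g(t-a) - q g(t-b) = 0`. Since `g` may jump, the renewal equation is
  -- integrated over `[0, t]` instead.
  set I : ℝ → ℝ := fun t => p * (∫ s in (t - a)..t, g s) + q * ∫ s in (t - b)..t, g s with hI
  have hconst : ∀ t, 0 ≤ t → I t = I 0 := by
    intro t ht
    have e1 : ∀ x, 0 < x → x ≤ max a b → (∫ s in (t - x)..t, g s) =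
        (∫ s in (0 - x)..0, g s) + (∫ s in (0:ℝ)..t, g s) - ∫ s in (0:ℝ)..t, g (s - x) := by
      intro x hx hxc
      rw [intervalIntegral.integral_comp_sub_right]
      have i1 := intervalIntegral.integral_add_adjacent_intervals
        (hint' (0 - x) (t - x) (by linarith) (by linarith))
        (hint' (t - x) t (by linarith) (by linarith))
      have i2 := intervalIntegral.integral_add_adjacent_intervals
        (hint' (0 - x) 0 (by linarith) (by linarith)) (hint' 0 t (by linarith) (by linarith))
      linarith
    have hs : ∀ x, 0 < x → x ≤ max a b → IntervalIntegrable (fun s => g (s - x)) volume 0 t := by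
      intro x hx hxc
      have := (hint' (0 - x) (t - x) (by linarith) (by linarith)).comp_sub_right x
      simpa using this
    have e2 : (∫ s in (0:ℝ)..t, g s) =
        p * (∫ s in (0:ℝ)..t, g (s - a)) + q * ∫ s in (0:ℝ)..t, g (s - b) := by
      rw [← intervalIntegral.integral_const_mul, ← intervalIntegral.integral_const_mul,
        ← intervalIntegral.integral_add ((hs a ha hca).const_mul p) ((hs b hb hcb).const_mul q)]
      refine intervalIntegral.integral_congr fun s hs => h.eq s ?_
      rw [Set.uIcc_of_le ht] at hs
      exact hs.1
    simp only [hI]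
    rw [e1 a ha hca, e1 b hb hcb]
    have e : q = 1 - p := by linarith [h.hpq]
    rw [e] at e2 ⊢
    linear_combination e2
  have hterm : ∀ x, 0 < x → x ≤ max a b →
      Tendsto (fun t => ∫ s in (t - x)..t, g s) atTop (𝓝 (x * L)) := by
    intro x hx hxc
    rw [Metric.tendsto_nhds]
    intro ε hε
    obtain ⟨T, hT⟩ := eventually_atTop.1
      (Metric.tendsto_nhds.1 hL (ε / (2 * x)) (by positivity))
    filter_upwards [eventually_ge_atTop (T + x), eventually_ge_atTop 0] with t ht ht0
    have e1 : (∫ s in (t - x)..t, g s) - x * L = ∫ s in (t - x)..t, (g s - L) := by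
      rw [intervalIntegral.integral_sub (hint' _ _ (by linarith) (by linarith)) (by simp)]
      simp
    rw [Real.dist_eq, e1, ← Real.norm_eq_abs]
    refine (intervalIntegral.norm_integral_le_of_norm_le_const (C := ε / (2 * x)) ?_).trans_lt ?_
    · intro s hs
      rw [Set.uIoc_of_le (by linarith)] at hs
      exact (hT s (by linarith [hs.1])).le
    · rw [sub_sub_cancel, abs_of_pos hx]
      field_simp
      linarith
  have hlim : Tendsto I atTop (𝓝 (p * (a * L) + q * (b * L))) :=
    ((hterm a ha hca).const_mul p).add ((hterm b hb hcb).const_mul q)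
  have hlim2 : Tendsto I atTop (𝓝 (I 0)) :=
    tendsto_const_nhds.congr' ((eventually_ge_atTop 0).mono fun t ht => (hconst t ht).symm)
  have := tendsto_nhds_unique hlim hlim2
  simp only [hI, zero_sub] at this
  rw [← this]
  ring

end RenewalSolution

/-! ### Recursions for sums over the leaves of the parsing tree -/

/-- The leaves of the parsing tree with threshold `r`; in contrast to `phrases`, the tree may
consist of its root only. -/
def leaves (p r : ℝ) : Set (List Bool) :=
  {α | stringProb p α < r ∧ ∀ (β : List Bool) (b : Bool), α = β ++ [b] → r ≤ stringProb p β}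

theorem leaves_eq_phrases {p r : ℝ} (hr : r ≤ 1) : leaves p r = phrases p r := by
  ext α
  rcases List.eq_nil_or_concat α with rfl | ⟨β, b, rfl⟩
  · simp [leaves, phrases, stringProb, hr]
  · simp only [leaves, phrases, Set.mem_ofPred_eq, List.concat_eq_append]
    refine and_congr_right fun _ => ⟨fun h => ⟨β, b, rfl, h β b rfl⟩, ?_⟩
    rintro ⟨β', b', h, hr⟩ β'' b'' h'
    have h1 := (List.append_inj' h rfl).1
    have h2 := (List.append_inj' h' rfl).1
    rw [← h2, h1]
    exact hr

theorem stringProb_cons (p : ℝ) (b : Bool) (α : List Bool) :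
    stringProb p (b :: α) = letterProb p b * stringProb p α := by
  simp [stringProb]

theorem stringProb_le_one {p : ℝ} (h0 : 0 < p) (h1 : p < 1) (α : List Bool) :
    stringProb p α ≤ 1 :=
  (stringProb_bounds h0 h1 α).2.trans
    (pow_le_one₀ (le_max_of_le_left h0.le) (by simp [h0.le, h1.le]))

theorem leaves_of_one_lt {p r : ℝ} (h0 : 0 < p) (h1 : p < 1) (hr : 1 < r) :
    leaves p r = {[]} := by
  ext α
  rcases List.eq_nil_or_concat α with rfl | ⟨β, b, rfl⟩
  · simp [leaves, stringProb, hr]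
  · simp only [leaves, Set.mem_ofPred_eq, List.concat_eq_append, Set.mem_singleton_iff]
    refine iff_of_false (fun h => ?_) (by simp)
    linarith [h.2 β b rfl, stringProb_le_one h0 h1 β]

theorem letterProb_pos {p : ℝ} (h0 : 0 < p) (h1 : p < 1) (b : Bool) : 0 < letterProb p b := by
  cases b <;> simp [letterProb, h0, h1]

/-- The subtree below a letter is a tree of the same kind with rescaled threshold. For a one-letter
string the parent is the root, whose condition has no counterpart on the right; `r ≤ 1` supplies it.
-/
theorem cons_mem_leaves {p r : ℝ} (h0 : 0 < p) (h1 : p < 1) (hr : r ≤ 1) (b : Bool)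
    (α : List Bool) : b :: α ∈ leaves p r ↔ α ∈ leaves p (r / letterProb p b) := by
  have hb := letterProb_pos h0 h1 b
  simp only [leaves, Set.mem_ofPred_eq, stringProb_cons, lt_div_iff₀' hb, div_le_iff₀' hb]
  refine and_congr_right fun _ => ⟨fun h β c hβ => ?_, fun h β c hβ => ?_⟩
  · rw [← stringProb_cons]
    exact h (b :: β) c (by rw [hβ, List.cons_append])
  · cases β with
    | nil => simpa [stringProb] using hr
    | cons b' β =>
      obtain ⟨rfl, h'⟩ := List.cons.inj hβ
      rw [stringProb_cons]
      exact h β c h'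

theorem leaves_eq_union {p r : ℝ} (h0 : 0 < p) (h1 : p < 1) (hr : r ≤ 1) :
    leaves p r = List.cons true '' leaves p (r / p) ∪ List.cons false '' leaves p (r / (1 - p)) := by
  ext α
  cases α with
  | nil => simp [leaves, stringProb, hr]
  | cons b α =>
    rw [cons_mem_leaves h0 h1 hr]
    cases b <;> simp [letterProb]

theorem leaves_finite {p r : ℝ} (h0 : 0 < p) (h1 : p < 1) (hr : 0 < r) :
    (leaves p r).Finite := by
  rcases le_or_gt r 1 with h | h
  · rw [leaves_eq_phrases h]
    exact phrases_finite h0 h1 hr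
  · rw [leaves_of_one_lt h0 h1 h]
    exact Set.finite_singleton _

/-- The sum of `w` over the leaves of the tree with threshold `e ^ (-t)`. -/
noncomputable def leafSum (p : ℝ) (w : List Bool → ℝ) (t : ℝ) : ℝ :=
  ∑ᶠ α ∈ leaves p (Real.exp (-t)), w α

theorem leafSum_of_neg {p : ℝ} (h0 : 0 < p) (h1 : p < 1) (w : List Bool → ℝ) {t : ℝ}
    (ht : t < 0) : leafSum p w t = w [] := by
  rw [leafSum, leaves_of_one_lt h0 h1 (by simpa using ht)]
  simp

/-- Dividing the threshold by a letter probability shifts `t` by its logarithm. A general weight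
lets one recursion serve the leaf count, the total probability and the mean depth. -/
theorem leafSum_rec {p : ℝ} (h0 : 0 < p) (h1 : p < 1) (w : List Bool → ℝ) {t : ℝ} (ht : 0 ≤ t) :
    leafSum p w t = leafSum p (fun α => w (true :: α)) (t + Real.log p) +
      leafSum p (fun α => w (false :: α)) (t + Real.log (1 - p)) := by
  have hq : 0 < 1 - p := by linarith
  have e : ∀ x, 0 < x → Real.exp (-(t + Real.log x)) = Real.exp (-t) / x := by
    intro x hx
    rw [neg_add, Real.exp_add, Real.exp_neg (Real.log x), Real.exp_log hx, div_eq_mul_inv]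
  have f1 := leaves_finite h0 h1 (r := Real.exp (-t) / p) (by positivity)
  have f2 := leaves_finite h0 h1 (r := Real.exp (-t) / (1 - p)) (by positivity)
  unfold leafSum
  rw [e p h0, e _ hq, leaves_eq_union h0 h1 (by simpa using ht),
    finsum_mem_union _ (f1.image _) (f2.image _), finsum_mem_image, finsum_mem_image]
  · exact fun x _ y _ h => by simpa using h
  · exact fun x _ y _ h => by simpa using h
  · rw [Set.disjoint_left]
    rintro _ ⟨x, -, rfl⟩ ⟨y, -, h⟩
    simp at h

theorem leafSum_add {p : ℝ} (h0 : 0 < p) (h1 : p < 1) (v w : List Bool → ℝ) (t : ℝ) :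
    leafSum p (fun α => v α + w α) t = leafSum p v t + leafSum p w t :=
  finsum_mem_add_distrib (leaves_finite h0 h1 (Real.exp_pos _))

theorem leafSum_const_mul (p c : ℝ) (w : List Bool → ℝ) (t : ℝ) :
    leafSum p (fun α => c * w α) t = c * leafSum p w t := by
  simp only [leafSum, ← smul_eq_mul]
  rw [smul_finsum]
  congr with α
  rw [smul_finsum]

/-- The number of leaves. -/
noncomputable def leafCount (p : ℝ) : ℝ → ℝ := leafSum p fun _ => 1

/-- The mean depth of a leaf. -/
noncomputable def meanDepth (p : ℝ) : ℝ → ℝ := leafSum p fun α => stringProb p α * α.length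

variable {p : ℝ}

theorem numPhrases_eq_leafCount (h0 : 0 < p) (h1 : p < 1) {R : ℝ} (hR : 1 ≤ R) :
    (numPhrases p R : ℝ) = leafCount p (Real.log R) := by
  have hR0 : 0 < R := by linarith
  have e : Real.exp (-Real.log R) = 1 / R := by
    rw [Real.exp_neg, Real.exp_log hR0, one_div]
  have hr : 1 / R ≤ 1 := by rw [div_le_one hR0]; exact hR
  have hfin := phrases_finite h0 h1 (r := 1 / R) (by positivity)
  rw [leafCount, leafSum, e, leaves_eq_phrases hr, finsum_mem_eq_finite_toFinset_sum _ hfin,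
    numPhrases, Set.ncard_eq_toFinset_card _ hfin]
  simp

theorem step_pos (h0 : 0 < p) (h1 : p < 1) :
    0 < min (-Real.log p) (-Real.log (1 - p)) :=
  lt_min (neg_pos.2 (Real.log_neg h0 h1)) (neg_pos.2 (Real.log_neg (by linarith) (by linarith)))

theorem leafCount_of_neg (h0 : 0 < p) (h1 : p < 1) {t : ℝ} (ht : t < 0) : leafCount p t = 1 :=
  leafSum_of_neg h0 h1 _ ht

theorem leafCount_rec (h0 : 0 < p) (h1 : p < 1) {t : ℝ} (ht : 0 ≤ t) :
    leafCount p t = leafCount p (t + Real.log p) + leafCount p (t + Real.log (1 - p)) :=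
  leafSum_rec h0 h1 _ ht

/-- Completeness of the tree. It makes the extra letter at the root contribute exactly 1 in
`meanDepth_rec`. -/
theorem leafSum_stringProb (h0 : 0 < p) (h1 : p < 1) (t : ℝ) :
    leafSum p (stringProb p) t = 1 := by
  refine renewal_induction (step_pos h0 h1) (P := fun t => leafSum p (stringProb p) t = 1)
    (fun t ht => ?_) (fun t ht ih => ?_) t
  · rw [leafSum_of_neg h0 h1 _ ht]; simp [stringProb]
  · rw [leafSum_rec h0 h1 _ ht]
    simp only [stringProb_cons, leafSum_const_mul]
    rw [ih _ (by linarith [min_le_left (-Real.log p) (-Real.log (1 - p))]),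
      ih _ (by linarith [min_le_right (-Real.log p) (-Real.log (1 - p))])]
    simp [letterProb]

theorem meanDepth_of_neg (h0 : 0 < p) (h1 : p < 1) {t : ℝ} (ht : t < 0) : meanDepth p t = 0 := by
  rw [meanDepth, leafSum_of_neg h0 h1 _ ht]; simp

theorem meanDepth_rec (h0 : 0 < p) (h1 : p < 1) {t : ℝ} (ht : 0 ≤ t) :
    meanDepth p t = 1 + p * meanDepth p (t + Real.log p) +
      (1 - p) * meanDepth p (t + Real.log (1 - p)) := by
  have e : ∀ b t, leafSum p (fun α => stringProb p (b :: α) * (b :: α).length) t =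
      letterProb p b * (meanDepth p t + 1) := by
    intro b t
    rw [meanDepth, ← leafSum_stringProb h0 h1 t, ← leafSum_add h0 h1, ← leafSum_const_mul]
    congr with α
    rw [stringProb_cons, List.length_cons]
    push_cast
    ring
  have key := leafSum_rec h0 h1 (fun α => stringProb p α * α.length) ht
  rw [e, e] at key
  simp only [letterProb, if_true, Bool.false_eq_true, if_false] at key
  refine Eq.trans key ?_
  ring

/-- The recursions at `s` and `t` are compared term by term. For `s < 0 ≤ t` only the one at `t` is
available, and the lower bound by the initial value replaces it. -/
theorem leafCount_mono (h0 : 0 < p) (h1 : p < 1) : Monotone (leafCount p) := by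
  have hl := min_le_left (-Real.log p) (-Real.log (1 - p))
  have hr := min_le_right (-Real.log p) (-Real.log (1 - p))
  have hone : ∀ t, 1 ≤ leafCount p t := by
    refine renewal_induction (step_pos h0 h1) (fun t ht => (leafCount_of_neg h0 h1 ht).ge)
      (fun t ht ih => ?_)
    rw [leafCount_rec h0 h1 ht]
    linarith [ih (t + Real.log p) (by linarith), ih (t + Real.log (1 - p)) (by linarith)]
  suffices H : ∀ t, ∀ s ≤ t, leafCount p s ≤ leafCount p t from fun s t hst => H t s hst
  refine renewal_induction (step_pos h0 h1) (fun t ht s hs => ?_) (fun t ht ih s hs => ?_)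
  · rw [leafCount_of_neg h0 h1 ht, leafCount_of_neg h0 h1 (hs.trans_lt ht)]
  · rcases lt_or_ge s 0 with hs0 | hs0
    · rw [leafCount_of_neg h0 h1 hs0]
      exact hone t
    · rw [leafCount_rec h0 h1 ht, leafCount_rec h0 h1 hs0]
      exact add_le_add (ih _ (by linarith) _ (by linarith)) (ih _ (by linarith) _ (by linarith))

theorem meanDepth_mono (h0 : 0 < p) (h1 : p < 1) : Monotone (meanDepth p) := by
  have hl := min_le_left (-Real.log p) (-Real.log (1 - p))
  have hr := min_le_right (-Real.log p) (-Real.log (1 - p))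
  have hq : 0 < 1 - p := by linarith
  have hone : ∀ t, 0 ≤ meanDepth p t := by
    refine renewal_induction (step_pos h0 h1) (fun t ht => (meanDepth_of_neg h0 h1 ht).ge)
      (fun t ht ih => ?_)
    rw [meanDepth_rec h0 h1 ht]
    have i1 := ih (t + Real.log p) (by linarith)
    have i2 := ih (t + Real.log (1 - p)) (by linarith)
    positivity
  suffices H : ∀ t, ∀ s ≤ t, meanDepth p s ≤ meanDepth p t from fun s t hst => H t s hst
  refine renewal_induction (step_pos h0 h1) (fun t ht s hs => ?_) (fun t ht ih s hs => ?_)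
  · rw [meanDepth_of_neg h0 h1 ht, meanDepth_of_neg h0 h1 (hs.trans_lt ht)]
  · rcases lt_or_ge s 0 with hs0 | hs0
    · rw [meanDepth_of_neg h0 h1 hs0]
      exact hone t
    · rw [meanDepth_rec h0 h1 ht, meanDepth_rec h0 h1 hs0]
      have i1 := ih (t + Real.log p) (by linarith) (s + Real.log p) (by linarith)
      have i2 := ih (t + Real.log (1 - p)) (by linarith) (s + Real.log (1 - p)) (by linarith)
      gcongr

/-! ### Normalization to renewal solutions, and the irrational case -/

theorem binEntropy_eq (p : ℝ) :
    Real.binEntropy p = p * -Real.log p + (1 - p) * -Real.log (1 - p) := by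
  rw [Real.binEntropy_eq_negMulLog_add_negMulLog_one_sub, Real.negMulLog, Real.negMulLog]
  ring

theorem leafCount_pos (h0 : 0 < p) (h1 : p < 1) (t : ℝ) : 0 < leafCount p t := by
  have h := leafCount_mono h0 h1 (min_le_left t (-1))
  rw [leafCount_of_neg h0 h1 (by simp)] at h
  linarith

/-- The factor `exp (-t)` creates the weights, because `exp (-a) = p` and `exp (-b) = q`. -/
theorem renewalSolution_leafCount (h0 : 0 < p) (h1 : p < 1) :
    RenewalSolution (-Real.log p) (-Real.log (1 - p)) p (1 - p)
      fun t => Real.exp (-t) * leafCount p t := by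
  have hq : 0 < 1 - p := by linarith
  have ha := neg_pos.2 (Real.log_neg h0 h1)
  have hb := neg_pos.2 (Real.log_neg hq (by linarith))
  have heq : ∀ t, 0 ≤ t → Real.exp (-t) * leafCount p t =
      p * (Real.exp (-(t - -Real.log p)) * leafCount p (t - -Real.log p)) +
      (1 - p) * (Real.exp (-(t - -Real.log (1 - p))) * leafCount p (t - -Real.log (1 - p))) := by
    intro t ht
    have e : ∀ x, 0 < x → x * Real.exp (-(t + Real.log x)) = Real.exp (-t) := by
      intro x hx
      rw [neg_add, Real.exp_add, Real.exp_neg (Real.log x), Real.exp_log hx]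
      field_simp
    rw [sub_neg_eq_add, sub_neg_eq_add, ← mul_assoc, ← mul_assoc, e p h0, e _ hq,
      leafCount_rec h0 h1 ht, mul_add]
  refine ⟨ha, hb, h0, hq, by ring, heq,
    Real.exp (max (-Real.log p) (-Real.log (1 - p))), ?_⟩
  refine bounded_of_renewal ha hb h0 hq (by ring) heq fun t ht ht0 => ?_
  rw [leafCount_of_neg h0 h1 ht0, mul_one, abs_of_pos (Real.exp_pos _), Real.exp_le_exp]
  linarith

/-- Subtracting `t` from `H V` cancels the inhomogeneous term, because `p a + q b = H`. -/
theorem renewalSolution_meanDepth (h0 : 0 < p) (h1 : p < 1) :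
    RenewalSolution (-Real.log p) (-Real.log (1 - p)) p (1 - p)
      fun t => Real.binEntropy p * meanDepth p t - t := by
  have hq : 0 < 1 - p := by linarith
  have ha := neg_pos.2 (Real.log_neg h0 h1)
  have hb := neg_pos.2 (Real.log_neg hq (by linarith))
  have heq : ∀ t, 0 ≤ t → Real.binEntropy p * meanDepth p t - t =
      p * (Real.binEntropy p * meanDepth p (t - -Real.log p) - (t - -Real.log p)) +
      (1 - p) * (Real.binEntropy p * meanDepth p (t - -Real.log (1 - p)) -
        (t - -Real.log (1 - p))) := by
    intro t ht
    rw [sub_neg_eq_add, sub_neg_eq_add, meanDepth_rec h0 h1 ht]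
    linear_combination binEntropy_eq p
  refine ⟨ha, hb, h0, hq, by ring, heq, max (-Real.log p) (-Real.log (1 - p)), ?_⟩
  refine bounded_of_renewal ha hb h0 hq (by ring) heq fun t ht ht0 => ?_
  rw [meanDepth_of_neg h0 h1 ht0, mul_zero, zero_sub, abs_neg, abs_of_neg ht0]
  linarith

theorem RenewalSolution.tendsto_of_irrational {a b p q : ℝ} {g : ℝ → ℝ}
    (h : RenewalSolution a b p q g) (hab : Irrational (a / b))
    {K : ℝ} (hK : 0 ≤ K)
    (hmono : ∀ s t, -max a b ≤ s → s ≤ t → g s + K * s ≤ g t + K * t) :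
    Tendsto g atTop
      (𝓝 ((p * (∫ t in (-a)..0, g t) + q * ∫ t in (-b)..0, g t) / (p * a + q * b))) := by
  obtain ⟨L, hL⟩ := h.exists_tendsto_of_irrational hab hK hmono
  have hpos : 0 < p * a + q * b := by
    have := h.ha; have := h.hb; have := h.hp; have := h.hq
    positivity
  rw [← h.limit_eq_integral hL, mul_div_cancel_left₀ _ hpos.ne']
  · exact hL
  · intro s t hs hst
    -- The monotonicity hypothesis also yields integrability: `g` is monotone up to a linear term.
    have h1 : MonotoneOn (fun t => g t + K * t) (Set.uIcc s t) := by
      rw [Set.uIcc_of_le hst]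
      exact fun x hx y _ hxy => hmono x y (hs.trans hx.1) hxy
    have h2 : IntervalIntegrable (fun t => K * t) volume s t :=
      (continuous_const.mul continuous_id).intervalIntegrable _ _
    simpa using (h1.intervalIntegrable (μ := volume)).sub h2

theorem irrational_log_ratio (h : ¬ ∃ c : ℚ, (c : ℝ) = Real.log p / Real.log (1 - p)) :
    Irrational (-Real.log p / -Real.log (1 - p)) := by
  rw [neg_div_neg_eq]
  exact fun ⟨c, hc⟩ => h ⟨c, hc⟩

/-- As `A` increases, `f(t) = exp (-t) A(t)` satisfies `f(t) ≥ (1 - (t - s)) f(s)`, so its upper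
bound `K` limits the rate of decrease. On the negative axis `A = 1`; the integrals are `1/p - 1` and
`1/q - 1`, with weighted sum `q + p = 1`. -/
theorem tendsto_leafCount_of_irrational (h0 : 0 < p) (h1 : p < 1)
    (h : ¬ ∃ c : ℚ, (c : ℝ) = Real.log p / Real.log (1 - p)) :
    Tendsto (fun t => Real.exp (-t) * leafCount p t) atTop (𝓝 (1 / Real.binEntropy p)) := by
  have hs := renewalSolution_leafCount h0 h1
  have hq : 0 < 1 - p := by linarith
  obtain ⟨K, hK⟩ := hs.bdd
  have hK0 : 0 ≤ K := (abs_nonneg _).trans (hK _ le_rfl)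
  have := hs.tendsto_of_irrational (irrational_log_ratio h) hK0 (fun s t hs hst => by
    have e1 : Real.exp (-t) = Real.exp (-s) * Real.exp (-(t - s)) := by
      rw [← Real.exp_add]; ring_nf
    have e2 := Real.add_one_le_exp (-(t - s))
    have e3 := (abs_le.1 (hK s hs)).2
    have e4 : 0 < Real.exp (-s) * leafCount p s :=
      mul_pos (Real.exp_pos _) (leafCount_pos h0 h1 s)
    have e5 : Real.exp (-t) * leafCount p s ≤ Real.exp (-t) * leafCount p t :=
      mul_le_mul_of_nonneg_left (leafCount_mono h0 h1 hst) (Real.exp_pos _).le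
    have e6 : (1 - (t - s)) * (Real.exp (-s) * leafCount p s) ≤
        Real.exp (-(t - s)) * (Real.exp (-s) * leafCount p s) :=
      mul_le_mul_of_nonneg_right (by linarith) e4.le
    have e7 : (t - s) * (Real.exp (-s) * leafCount p s) ≤ (t - s) * K :=
      mul_le_mul_of_nonneg_left e3 (by linarith)
    rw [e1] at e5 ⊢
    linarith)
  have hint : ∀ x, 0 < x → x < 1 → (∫ t in (- -Real.log x)..0, Real.exp (-t) * leafCount p t) =
      1 / x - 1 := by
    intro x hx0 hx1
    have hlog := Real.log_neg hx0 hx1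
    rw [neg_neg]
    have : (∫ t in (Real.log x)..0, Real.exp (-t) * leafCount p t) =
        ∫ t in (Real.log x)..0, Real.exp (-t) := by
      refine intervalIntegral.integral_congr_uIoo fun t ht => ?_
      rw [Set.uIoo_of_le hlog.le] at ht
      simp [leafCount_of_neg h0 h1 ht.2]
    rw [this, intervalIntegral.integral_comp_neg, integral_exp, Real.exp_neg, Real.exp_log hx0]
    simp
  rw [hint p h0 h1, hint _ hq (by linarith), ← binEntropy_eq] at this
  convert this using 3
  field_simp
  ring

/-- `H V` increases, so `K = 1` will do. On the negative axis the solution is `-t`, whose integrals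
`a² / 2` and `b² / 2` produce `H₂ / (2 H)`. -/
theorem tendsto_meanDepth_of_irrational (h0 : 0 < p) (h1 : p < 1)
    (h : ¬ ∃ c : ℚ, (c : ℝ) = Real.log p / Real.log (1 - p)) :
    Tendsto (fun t => meanDepth p t -
      (t / Real.binEntropy p + secondMoment p / (2 * Real.binEntropy p ^ 2))) atTop (𝓝 0) := by
  have hs := renewalSolution_meanDepth h0 h1
  have hq : 0 < 1 - p := by linarith
  have hH := Real.binEntropy_pos h0 h1
  have := hs.tendsto_of_irrational (irrational_log_ratio h) zero_le_one (fun s t hs hst => by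
    have := mul_le_mul_of_nonneg_left (meanDepth_mono h0 h1 hst) hH.le
    linarith)
  have hint : ∀ x, 0 < x → x < 1 →
      (∫ t in (- -Real.log x)..0, (Real.binEntropy p * meanDepth p t - t)) =
        Real.log x ^ 2 / 2 := by
    intro x hx0 hx1
    have hlog := Real.log_neg hx0 hx1
    rw [neg_neg]
    have : (∫ t in (Real.log x)..0, (Real.binEntropy p * meanDepth p t - t)) =
        ∫ t in (Real.log x)..0, -t := by
      refine intervalIntegral.integral_congr_uIoo fun t ht => ?_
      rw [Set.uIoo_of_le hlog.le] at ht
      simp [meanDepth_of_neg h0 h1 ht.2]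
    rw [this, intervalIntegral.integral_neg, integral_id]
    ring
  rw [hint p h0 h1, hint _ hq (by linarith), ← binEntropy_eq] at this
  have h2 := ((this.sub_const (secondMoment p / (2 * Real.binEntropy p))).div_const
    (Real.binEntropy p))
  refine (h2.congr fun t => ?_).trans_eq ?_
  · field_simp
    ring
  · congr 1
    rw [secondMoment]
    field_simp
    ring

/-! ### The lattice case -/

/-- A common factor of the two multipliers could be absorbed into `d`, against its maximality. -/
theorem exists_coprime_of_realGcd (h0 : 0 < p) (h1 : p < 1)
    (h : ∃ c : ℚ, (c : ℝ) = Real.log p / Real.log (1 - p)) :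
    0 < realGcd (Real.log p) (Real.log (1 - p)) ∧ ∃ m n : ℕ, Nat.Coprime m n ∧
      -Real.log p = m * realGcd (Real.log p) (Real.log (1 - p)) ∧
      -Real.log (1 - p) = n * realGcd (Real.log p) (Real.log (1 - p)) := by
  have hp := Real.log_neg h0 h1
  have hq := Real.log_neg (show 0 < 1 - p by linarith) (by linarith)
  obtain ⟨⟨hd, m, n, hm, hn⟩, hmax⟩ := isGreatest_realGcd hp.ne hq.ne h
  set d := realGcd (Real.log p) (Real.log (1 - p)) with hdd
  have hneg : ∀ (x : ℝ) (k : ℤ), x < 0 → x = k * d → ((k.natAbs : ℕ) : ℝ) = -k := by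
    intro x k hx hk
    have : (k : ℝ) < 0 := by
      by_contra! h
      have : 0 ≤ k * d := by positivity
      linarith
    rw [Nat.cast_natAbs, abs_of_neg (by exact_mod_cast this)]
    push_cast; rfl
  refine ⟨hd, m.natAbs, n.natAbs, ?_, ?_, ?_⟩
  · have hg0 : 0 < Int.gcd m n := by
      refine Int.gcd_pos_of_ne_zero_left _ ?_
      rintro rfl
      rw [Int.cast_zero, zero_mul] at hm
      exact hp.ne hm
    have hmem : (Int.gcd m n : ℝ) * d ∈ commonDivisors (Real.log p) (Real.log (1 - p)) := by
      obtain ⟨m', hm'⟩ := Int.gcd_dvd_left m n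
      obtain ⟨n', hn'⟩ := Int.gcd_dvd_right m n
      refine ⟨by positivity, m', n', ?_, ?_⟩
      · rw [hm]
        nth_rw 1 [hm']
        push_cast; ring
      · rw [hn]
        nth_rw 1 [hn']
        push_cast; ring
    have hle := hmax hmem
    have : (Int.gcd m n : ℝ) ≤ 1 := by
      by_contra! h
      nlinarith
    have : Int.gcd m n ≤ 1 := by exact_mod_cast this
    have : Int.gcd m n = 1 := by omega
    exact this
  · rw [hneg _ _ hp hm, hm]; ring
  · rw [hneg _ _ hq hn, hn]; ring

theorem floor_shift {d : ℝ} (hd : 0 < d) (m : ℕ) (t : ℝ) :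
    d * ⌊(t - m * d) / d⌋ = d * ⌊t / d⌋ - m * d := by
  have : (t - m * d) / d = t / d - (m : ℕ) := by field_simp
  rw [this, Int.floor_sub_natCast]
  push_cast
  ring

/-- Shifts by multiples of `d` commute with rounding down to the lattice. -/
theorem RenewalSolution.comp_floor {a b p q : ℝ} {g : ℝ → ℝ} (h : RenewalSolution a b p q g)
    {d : ℝ} (hd : 0 < d) {m n : ℕ} (ham : a = m * d) (hbn : b = n * d) :
    RenewalSolution a b p q fun t => g (d * ⌊t / d⌋) where
  ha := h.ha
  hb := h.hb
  hp := h.hp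
  hq := h.hq
  hpq := h.hpq
  eq t ht := by
    have : (0 : ℝ) ≤ d * ⌊t / d⌋ := by
      have : 0 ≤ ⌊t / d⌋ := Int.floor_nonneg.2 (by positivity)
      positivity
    rw [h.eq _ this, ham, hbn, floor_shift hd, floor_shift hd]
  bdd := by
    obtain ⟨K, hK⟩ := h.bdd
    refine ⟨K, fun t ht => hK _ ?_⟩
    -- The left end `-max a b` is a lattice point, so rounding down does not leave the range of the
    -- bound.
    obtain ⟨k, hk⟩ : ∃ k : ℕ, max a b = k * d := by
      rcases max_choice a b with h | h
      · exact ⟨m, h.trans ham⟩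
      · exact ⟨n, h.trans hbn⟩
    have h1 : (-k : ℤ) ≤ ⌊t / d⌋ := by
      rw [Int.le_floor, le_div_iff₀ hd]
      push_cast
      linarith
    have h2 : (-k : ℝ) ≤ ⌊t / d⌋ := by exact_mod_cast h1
    rw [hk, mul_comm d]
    calc -(k * d) = -k * d := by ring
      _ ≤ _ := by gcongr

theorem RenewalSolution.tendsto_of_lattice {a b p q : ℝ} {g : ℝ → ℝ}
    (h : RenewalSolution a b p q g) {d : ℝ} (hd : 0 < d) {m n : ℕ}
    (ham : a = m * d) (hbn : b = n * d) (hmn : Nat.Coprime m n) :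
    Tendsto (fun t => g (d * ⌊t / d⌋)) atTop
      (𝓝 (d * (p * ∑ i ∈ Finset.range m, g (-((i + 1 : ℕ) * d)) +
        q * ∑ i ∈ Finset.range n, g (-((i + 1 : ℕ) * d))) / (p * a + q * b))) := by
  have hfl : ∀ k : ℤ, d * ⌊k * d / d⌋ = k * d := by
    intro k
    rw [mul_div_cancel_right₀ _ hd.ne', Int.floor_intCast, mul_comm]
  have hflo : ∀ t : ℝ, d * ⌊d * ⌊t / d⌋ / d⌋ = d * ⌊t / d⌋ := by
    intro t
    rw [mul_div_cancel_left₀ _ hd.ne', Int.floor_intCast]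
  have h' := h.comp_floor hd ham hbn
  obtain ⟨L, hL⟩ := h'.exists_tendsto_of_lattice hd ham hbn hmn
    (fun t => by rw [hflo])
  have hlim := h'.limit_of_lattice hd ham hbn hL
  have e : ∀ i : ℕ, d * ⌊-((i + 1 : ℕ) * d) / d⌋ = -((i + 1 : ℕ) * d) := by
    intro i
    have := hfl (-(i + 1 : ℕ))
    push_cast at this ⊢
    rwa [neg_mul] at this
  simp only [e] at hlim
  rw [← hlim]
  have hpos : 0 < p * a + q * b := by
    have := h.ha; have := h.hb; have := h.hp; have := h.hq
    positivity
  convert hL using 2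
  rw [div_eq_iff hpos.ne', ham, hbn]
  ring

section Lattice

variable {d : ℝ} {m n : ℕ}

/-- All string probabilities are powers of `exp (-d)`, so the tree changes only at lattice times.
The same holds for `meanDepth_floor`. -/
theorem leafCount_floor (h0 : 0 < p) (h1 : p < 1) (hd : 0 < d) (ham : -Real.log p = m * d)
    (hbn : -Real.log (1 - p) = n * d) (t : ℝ) :
    leafCount p (d * ⌊t / d⌋) = leafCount p t := by
  refine renewal_induction (step_pos h0 h1)
    (P := fun t => leafCount p (d * ⌊t / d⌋) = leafCount p t) (fun t ht => ?_)
    (fun t ht ih => ?_) t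
  · have : ⌊t / d⌋ < 0 := Int.floor_lt.2 (by simpa using div_neg_of_neg_of_pos ht hd)
    rw [leafCount_of_neg h0 h1 ht, leafCount_of_neg h0 h1]
    exact mul_neg_of_pos_of_neg hd (by exact_mod_cast this)
  · have hfl : (0 : ℝ) ≤ d * ⌊t / d⌋ := by
      have : 0 ≤ ⌊t / d⌋ := Int.floor_nonneg.2 (by positivity)
      positivity
    have i1 := ih (t + Real.log p) (by linarith [min_le_left (-Real.log p) (-Real.log (1 - p))])
    have i2 := ih (t + Real.log (1 - p))
      (by linarith [min_le_right (-Real.log p) (-Real.log (1 - p))])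
    rw [leafCount_rec h0 h1 ht, leafCount_rec h0 h1 hfl, ← i1, ← i2,
      ← sub_neg_eq_add t, ← sub_neg_eq_add t, ham, hbn, floor_shift hd, floor_shift hd, ← ham,
      ← hbn, sub_neg_eq_add, sub_neg_eq_add]

theorem meanDepth_floor (h0 : 0 < p) (h1 : p < 1) (hd : 0 < d) (ham : -Real.log p = m * d)
    (hbn : -Real.log (1 - p) = n * d) (t : ℝ) :
    meanDepth p (d * ⌊t / d⌋) = meanDepth p t := by
  refine renewal_induction (step_pos h0 h1)
    (P := fun t => meanDepth p (d * ⌊t / d⌋) = meanDepth p t) (fun t ht => ?_)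
    (fun t ht ih => ?_) t
  · have : ⌊t / d⌋ < 0 := Int.floor_lt.2 (by simpa using div_neg_of_neg_of_pos ht hd)
    rw [meanDepth_of_neg h0 h1 ht, meanDepth_of_neg h0 h1]
    exact mul_neg_of_pos_of_neg hd (by exact_mod_cast this)
  · have hfl : (0 : ℝ) ≤ d * ⌊t / d⌋ := by
      have : 0 ≤ ⌊t / d⌋ := Int.floor_nonneg.2 (by positivity)
      positivity
    have i1 := ih (t + Real.log p) (by linarith [min_le_left (-Real.log p) (-Real.log (1 - p))])
    have i2 := ih (t + Real.log (1 - p))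
      (by linarith [min_le_right (-Real.log p) (-Real.log (1 - p))])
    rw [meanDepth_rec h0 h1 ht, meanDepth_rec h0 h1 hfl, ← i1, ← i2,
      ← sub_neg_eq_add t, ← sub_neg_eq_add t, ham, hbn, floor_shift hd, floor_shift hd, ← ham,
      ← hbn, sub_neg_eq_add, sub_neg_eq_add]

theorem mul_floor_eq_sub_fract (hd : 0 < d) (t : ℝ) : d * ⌊t / d⌋ = t - d * Int.fract (t / d) := by
  rw [Int.fract, mul_sub, mul_div_cancel₀ _ hd.ne']
  ring

/-- The initial data form geometric sums, `∑_{i=1}^m exp (i d) = (1/p - 1) / (1 - exp (-d))`. The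
oscillating factor arises because the leaf count sees only `d ⌊t / d⌋` while `exp (-t)` sees `t`. -/
theorem tendsto_leafCount_of_lattice (h0 : 0 < p) (h1 : p < 1) (hd : 0 < d)
    (ham : -Real.log p = m * d) (hbn : -Real.log (1 - p) = n * d) (hmn : Nat.Coprime m n) :
    Tendsto (fun t => Real.exp (-t) * leafCount p t -
      1 / Real.binEntropy p * (d / (1 - Real.exp (-d))) *
        Real.exp (-d * Int.fract (t / d))) atTop (𝓝 0) := by
  have hq : 0 < 1 - p := by linarith
  have hH := Real.binEntropy_pos h0 h1
  have hlim := (renewalSolution_leafCount h0 h1).tendsto_of_lattice hd ham hbn hmn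
  have hed : 1 < Real.exp d := Real.one_lt_exp_iff.2 hd
  have hsum : ∀ (x : ℝ) (k : ℕ), 0 < x → -Real.log x = k * d →
      ∑ i ∈ Finset.range k, Real.exp (- -((i + 1 : ℕ) * d)) * leafCount p (-((i + 1 : ℕ) * d)) =
        (1 / x - 1) / (1 - Real.exp (-d)) := by
    intro x k hx hxk
    have e1 : ∀ i : ℕ,
        Real.exp (- -((i + 1 : ℕ) * d)) * leafCount p (-((i + 1 : ℕ) * d)) =
          Real.exp d * Real.exp d ^ i := by
      intro i
      rw [leafCount_of_neg h0 h1 (neg_neg_of_pos (by positivity)), mul_one, neg_neg,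
        Real.exp_nat_mul, pow_succ']
    have e2 : Real.exp d ^ k = 1 / x := by
      rw [← Real.exp_nat_mul, ← hxk, Real.exp_neg, Real.exp_log hx, one_div]
    simp only [e1]
    rw [← Finset.mul_sum, geom_sum_eq hed.ne', e2, Real.exp_neg]
    have h2 : Real.exp d - 1 ≠ 0 := by linarith
    have h3 : 1 - (Real.exp d)⁻¹ ≠ 0 := by
      have : (Real.exp d)⁻¹ < 1 := inv_lt_one_of_one_lt₀ hed
      linarith
    field_simp
  rw [hsum p m h0 ham, hsum _ n hq hbn, ← binEntropy_eq] at hlim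
  set L := 1 / Real.binEntropy p * (d / (1 - Real.exp (-d))) with hLdef
  have hL : d * (p * ((1 / p - 1) / (1 - Real.exp (-d))) +
      (1 - p) * ((1 / (1 - p) - 1) / (1 - Real.exp (-d)))) / Real.binEntropy p = L := by
    have h3 : 1 - Real.exp (-d) ≠ 0 := by
      have : Real.exp (-d) < 1 := Real.exp_lt_one_iff.2 (by linarith)
      linarith
    rw [hLdef]
    field_simp
    ring
  rw [hL] at hlim
  have hlim0 := tendsto_sub_nhds_zero_iff.2 hlim
  refine squeeze_zero_norm (fun t => ?_) (tendsto_zero_iff_norm_tendsto_zero.1 hlim0)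
  have e3 : Real.exp (-t) = Real.exp (-d * Int.fract (t / d)) * Real.exp (-(d * ⌊t / d⌋)) := by
    rw [← Real.exp_add, mul_floor_eq_sub_fract hd]
    ring_nf
  have e4 : Real.exp (-t) * leafCount p t - L * Real.exp (-d * Int.fract (t / d)) =
      Real.exp (-d * Int.fract (t / d)) *
        (Real.exp (-(d * ⌊t / d⌋)) * leafCount p (d * ⌊t / d⌋) - L) := by
    rw [leafCount_floor h0 h1 hd ham hbn, e3]
    ring
  rw [e4, norm_mul]
  refine mul_le_of_le_one_left (norm_nonneg _) ?_
  rw [Real.norm_eq_abs, Real.abs_exp, Real.exp_le_one_iff]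
  have := mul_nonneg hd.le (Int.fract_nonneg (t / d))
  linarith

/-- Here the sums `d m (m + 1) / 2` exceed their integral analogue, which adds `d / 2` to the limit
`H₂ / (2 H)`. Replacing `d ⌊t / d⌋` by `t` contributes the fractional part. -/
theorem tendsto_meanDepth_of_lattice (h0 : 0 < p) (h1 : p < 1) (hd : 0 < d)
    (ham : -Real.log p = m * d) (hbn : -Real.log (1 - p) = n * d) (hmn : Nat.Coprime m n) :
    Tendsto (fun t => meanDepth p t -
      (t / Real.binEntropy p + secondMoment p / (2 * Real.binEntropy p ^ 2) +
        d / Real.binEntropy p * (1 / 2 - Int.fract (t / d)))) atTop (𝓝 0) := by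
  have hH := Real.binEntropy_pos h0 h1
  have hlim := (renewalSolution_meanDepth h0 h1).tendsto_of_lattice hd ham hbn hmn
  have hsum : ∀ (k : ℕ),
      ∑ i ∈ Finset.range k, (Real.binEntropy p * meanDepth p (-((i + 1 : ℕ) * d)) -
        -((i + 1 : ℕ) * d)) = d * (k * (k + 1) / 2) := by
    intro k
    induction k with
    | zero => simp
    | succ k ih =>
      rw [Finset.sum_range_succ, ih, meanDepth_of_neg h0 h1 (neg_neg_of_pos (by positivity))]
      push_cast
      ring
  rw [hsum, hsum, ← binEntropy_eq] at hlim
  have h2 := ((hlim.sub_const (secondMoment p / (2 * Real.binEntropy p) + d / 2)).div_const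
    (Real.binEntropy p))
  refine (h2.congr fun t => ?_).trans_eq ?_
  · rw [meanDepth_floor h0 h1 hd ham hbn, mul_floor_eq_sub_fract hd]
    field_simp
    ring
  · congr 1
    have hH' := binEntropy_eq p
    have hS : secondMoment p = p * (-Real.log p) ^ 2 + (1 - p) * (-Real.log (1 - p)) ^ 2 := by
      rw [secondMoment]; ring
    rw [ham, hbn] at hH' hS
    rw [div_eq_zero_iff]
    left
    rw [hS]
    field_simp
    rw [hH']
    ring

end Lattice

/-! ### First passage times -/

/-- The size `-ln P(b)` of the step belonging to the letter `b`. -/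
noncomputable def letterStep (p : ℝ) (b : Bool) : ℝ := -Real.log (letterProb p b)

theorem partialSum_eq_sum (p : ℝ) (s : ℕ → Bool) (n : ℕ) :
    partialSum p s n = ∑ i ∈ Finset.range n, letterStep p (s i) := rfl

theorem partialSum_succ (p : ℝ) (s : ℕ → Bool) (n : ℕ) :
    partialSum p s (n + 1) = partialSum p s n + letterStep p (s n) :=
  Finset.sum_range_succ _ _

/-- The smallest step. -/
noncomputable def minStep (p : ℝ) : ℝ := min (-Real.log p) (-Real.log (1 - p))

/-- The largest step. -/
noncomputable def maxStep (p : ℝ) : ℝ := max (-Real.log p) (-Real.log (1 - p))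

theorem minStep_le (p : ℝ) (b : Bool) : minStep p ≤ letterStep p b := by
  cases b <;> simp [minStep, letterStep, letterProb]

theorem le_maxStep (p : ℝ) (b : Bool) : letterStep p b ≤ maxStep p := by
  cases b <;> simp [maxStep, letterStep, letterProb]

theorem minStep_pos (h0 : 0 < p) (h1 : p < 1) : 0 < minStep p := step_pos h0 h1

theorem maxStep_pos (h0 : 0 < p) (h1 : p < 1) : 0 < maxStep p :=
  (minStep_pos h0 h1).trans_le (min_le_max)

theorem partialSum_strictMono (h0 : 0 < p) (h1 : p < 1) (s : ℕ → Bool) :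
    StrictMono (partialSum p s) :=
  strictMono_nat_of_lt_succ fun n => by
    rw [partialSum_succ]
    linarith [minStep_pos h0 h1, minStep_le p (s n)]

theorem mul_minStep_le_partialSum (p : ℝ) (s : ℕ → Bool) (n : ℕ) :
    n * minStep p ≤ partialSum p s n := by
  rw [partialSum_eq_sum, ← nsmul_eq_mul]
  simpa using Finset.card_nsmul_le_sum (Finset.range n) (fun i => letterStep p (s i)) (minStep p)
    fun i _ => minStep_le p (s i)

theorem stringProb_pre (h0 : 0 < p) (h1 : p < 1) (s : ℕ → Bool) (n : ℕ) :
    stringProb p (pre s n) = Real.exp (-partialSum p s n) := by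
  induction n with
  | zero => simp [pre, stringProb, partialSum]
  | succ n ih =>
    rw [pre_succ, stringProb_append, ih, partialSum_succ, neg_add, Real.exp_add, letterStep,
      neg_neg, Real.exp_log (letterProb_pos h0 h1 _)]

theorem nu_spec (h0 : 0 < p) (h1 : p < 1) (t : ℝ) (s : ℕ → Bool) :
    t < partialSum p s (nu p t s) := by
  refine Nat.sInf_mem (s := {n | t < partialSum p s n}) ?_
  obtain ⟨n, hn⟩ := exists_nat_gt (t / minStep p)
  exact ⟨n, ((div_lt_iff₀ (minStep_pos h0 h1)).1 hn).trans_le (mul_minStep_le_partialSum p s n)⟩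

/-- Positive steps make the walk increasing, so it never returns below `t`. Thus `i < ν` is decided
by the first `i` letters, which makes its indicator predictable. -/
theorem lt_nu_iff (h0 : 0 < p) (h1 : p < 1) (t : ℝ) (s : ℕ → Bool) (i : ℕ) :
    i < nu p t s ↔ partialSum p s i ≤ t := by
  refine ⟨fun h => not_lt.1 (Nat.notMem_of_lt_sInf h), fun h => ?_⟩
  by_contra! hle
  have := (partialSum_strictMono h0 h1 s).monotone hle
  linarith [nu_spec h0 h1 t s]

theorem nu_pos (h0 : 0 < p) (h1 : p < 1) {t : ℝ} (ht : 0 ≤ t) (s : ℕ → Bool) :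
    0 < nu p t s := by
  rw [lt_nu_iff h0 h1]
  simpa [partialSum] using ht

/-- The overshoot is at most one step. -/
theorem partialSum_nu_le (h0 : 0 < p) (h1 : p < 1) {t : ℝ} (ht : 0 ≤ t) (s : ℕ → Bool) :
    partialSum p s (nu p t s) ≤ t + maxStep p := by
  obtain ⟨k, hk⟩ := Nat.exists_eq_succ_of_ne_zero (nu_pos h0 h1 ht s).ne'
  have : partialSum p s k ≤ t := (lt_nu_iff h0 h1 t s k).1 (by omega)
  rw [hk, Nat.succ_eq_add_one, partialSum_succ]
  linarith [le_maxStep p (s k)]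

/-- A deterministic bound: every stopped quantity depends on finitely many letters, so all moments
exist and Wald's identities reduce to finite sums. -/
theorem nu_le (h0 : 0 < p) (h1 : p < 1) {t : ℝ} (ht : 0 ≤ t) (s : ℕ → Bool) :
    (nu p t s : ℝ) ≤ (t + maxStep p) / minStep p := by
  rw [le_div_iff₀ (minStep_pos h0 h1)]
  exact (mul_minStep_le_partialSum p s _).trans (partialSum_nu_le h0 h1 ht s)

theorem pre_mem_leaves_iff (h0 : 0 < p) (h1 : p < 1) (t : ℝ) (s : ℕ → Bool)
    (n : ℕ) : pre s n ∈ leaves p (Real.exp (-t)) ↔ n = nu p t s := by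
  have hmem : pre s n ∈ leaves p (Real.exp (-t)) ↔
      t < partialSum p s n ∧ ∀ k, n = k + 1 → partialSum p s k ≤ t := by
    simp only [leaves, Set.mem_ofPred_eq, stringProb_pre h0 h1, Real.exp_lt_exp, neg_lt_neg_iff]
    refine and_congr_right fun _ => ⟨?_, ?_⟩
    · rintro h k rfl
      have := h _ _ (pre_succ s k)
      rwa [stringProb_pre h0 h1, Real.exp_le_exp, neg_le_neg_iff] at this
    · intro h β b hβ
      cases n with
      | zero => simp [pre] at hβ
      | succ k =>
        rw [pre_succ] at hβ
        rw [← (List.append_inj' hβ rfl).1, stringProb_pre h0 h1, Real.exp_le_exp, neg_le_neg_iff]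
        exact h k rfl
  rw [hmem]
  constructor
  · rintro ⟨h2, h3⟩
    refine le_antisymm ?_ (Nat.sInf_le h2)
    cases n with
    | zero => exact Nat.zero_le _
    | succ k => exact (lt_nu_iff h0 h1 t s k).2 (h3 k rfl)
  · rintro rfl
    exact ⟨nu_spec h0 h1 t s, fun k hk => (lt_nu_iff h0 h1 t s k).1 (by omega)⟩

theorem phraseLength_eq_nu (h0 : 0 < p) (h1 : p < 1) {R : ℝ} (hR : 1 ≤ R) (s : ℕ → Bool) :
    phraseLength p R s = nu p (Real.log R) s := by
  have hR0 : 0 < R := by linarith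
  have e : Real.exp (-Real.log R) = 1 / R := by
    rw [Real.exp_neg, Real.exp_log hR0, one_div]
  have hr : 1 / R ≤ 1 := by rw [div_le_one hR0]; exact hR
  have : {n | pre s n ∈ phrases p (1 / R)} = {nu p (Real.log R) s} := by
    ext n
    rw [← leaves_eq_phrases hr, ← e]
    exact pre_mem_leaves_iff h0 h1 (Real.log R) s n
  rw [phraseLength, this, csInf_singleton]

/-! ### I.i.d. letters -/

/-- The letters `ξ i` are independent, and `true` has probability `p`. -/
structure IsBernoulliString {Ω : Type*} [MeasurableSpace Ω] (p : ℝ) (μ : Measure Ω)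
    (ξ : ℕ → Ω → Bool) : Prop where
  meas : ∀ i, Measurable (ξ i)
  indep : iIndepFun ξ μ
  prob : ∀ i, μ.real {ω | ξ i ω = true} = p

namespace IsBernoulliString

variable {Ω : Type*} [MeasurableSpace Ω] {μ : Measure Ω} {ξ : ℕ → Ω → Bool}

/-- The function factors through a finite discrete product; letters from `n` on are filled in with
`false`. -/
theorem measurable_of_dependsOn (h : IsBernoulliString p μ ξ) {c : (ℕ → Bool) → ℝ} {n : ℕ}
    (hc : DependsOn c (Set.Iio n)) : Measurable fun ω => c fun i => ξ i ω := by
  have e : (fun ω => c fun i => ξ i ω) = (fun x : Finset.range n → Bool =>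
      c fun i => if hi : i ∈ Finset.range n then x ⟨i, hi⟩ else false) ∘
        fun ω (i : Finset.range n) => ξ i ω := by
    ext ω
    refine hc fun i hi => ?_
    have : i < n := hi
    simp [this]
  rw [e]
  exact (measurable_of_finite _).comp (measurable_pi_lambda _ fun i => h.meas i)

theorem measurable_phraseLength (h : IsBernoulliString p μ ξ) (R : ℝ) :
    Measurable fun ω => phraseLength p R fun i => ξ i ω := by
  have hA : ∀ n, MeasurableSet {ω | pre (fun i => ξ i ω) n ∈ phrases p (1 / R)} := by
    intro n
    have e : {ω | pre (fun i => ξ i ω) n ∈ phrases p (1 / R)} =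
        (fun ω (i : Fin n) => ξ i ω) ⁻¹' {x | List.ofFn x ∈ phrases p (1 / R)} := by
      ext ω
      have : pre (fun i => ξ i ω) n = List.ofFn fun i : Fin n => ξ i ω := by
        refine List.ext_getElem (by simp [pre]) fun i h1 h2 => ?_
        simp [pre]
      simp [this]
    rw [e]
    exact measurable_pi_lambda _ (fun i : Fin n => h.meas i) (Set.toFinite _).measurableSet
  refine measurable_of_Iic fun i => ?_
  -- For arbitrary `R` a string may have no prefix in the dictionary; then the infimum of the empty
  -- set is 0, which accounts for the second set.
  have e : (fun ω => phraseLength p R fun i => ξ i ω) ⁻¹' Set.Iic i =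
      (⋃ n ∈ Set.Iic i, {ω | pre (fun i => ξ i ω) n ∈ phrases p (1 / R)}) ∪
        ⋂ n, {ω | pre (fun i => ξ i ω) n ∈ phrases p (1 / R)}ᶜ := by
    ext ω
    simp only [Set.mem_preimage, Set.mem_Iic, Set.mem_union, Set.mem_iUnion, Set.mem_iInter,
      Set.mem_compl_iff, phraseLength, Set.mem_ofPred_eq, exists_prop]
    constructor
    · intro hle
      rcases Set.eq_empty_or_nonempty {n | pre (fun i => ξ i ω) n ∈ phrases p (1 / R)} with h | h
      · exact Or.inr fun n hn => (h ▸ hn : n ∈ (∅ : Set ℕ))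
      · exact Or.inl ⟨_, hle, Nat.sInf_mem h⟩
    · rintro (⟨n, hn, hmem⟩ | hn)
      · exact (Nat.sInf_le hmem).trans hn
      · have : {n | pre (fun i => ξ i ω) n ∈ phrases p (1 / R)} = ∅ :=
          Set.eq_empty_of_forall_notMem hn
        rw [this]
        simp
  rw [e]
  exact (MeasurableSet.biUnion (Set.to_countable _) fun n _ => hA n).union
    (MeasurableSet.iInter fun n => (hA n).compl)

variable [IsProbabilityMeasure μ]

theorem prob_letter (h : IsBernoulliString p μ ξ) (i : ℕ) (b : Bool) :
    μ.real (ξ i ⁻¹' {b}) = letterProb p b := by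
  have ht : μ.real (ξ i ⁻¹' {true}) = p := h.prob i
  cases b
  · have : ξ i ⁻¹' {false} = (ξ i ⁻¹' {true})ᶜ := by ext; simp
    rw [this, probReal_compl_eq_one_sub (h.meas i (measurableSet_singleton _)), ht]
    simp [letterProb]
  · rw [ht]; simp [letterProb]

theorem integral_letter (h : IsBernoulliString p μ ξ) (i : ℕ) (ψ : Bool → ℝ) :
    ∫ ω, ψ (ξ i ω) ∂μ = p * ψ true + (1 - p) * ψ false := by
  have hm : ∀ b, MeasurableSet (ξ i ⁻¹' {b}) := fun b => h.meas i (measurableSet_singleton b)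
  have e : (fun ω => ψ (ξ i ω)) = fun ω => (ξ i ⁻¹' {true}).indicator (fun _ => ψ true) ω +
      (ξ i ⁻¹' {false}).indicator (fun _ => ψ false) ω := by
    ext ω
    cases hb : ξ i ω <;> simp [Set.indicator, hb]
  rw [e, integral_add ((integrable_const _).indicator (hm _))
    ((integrable_const _).indicator (hm _)), integral_indicator_const _ (hm _),
    integral_indicator_const _ (hm _), h.prob_letter, h.prob_letter]
  simp [letterProb]

theorem prob_pre (h : IsBernoulliString p μ ξ) (s : ℕ → Bool) (n : ℕ) :
    μ.real {ω | pre (fun i => ξ i ω) n = pre s n} = stringProb p (pre s n) := by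
  have e : {ω | pre (fun i => ξ i ω) n = pre s n} =
      ⋂ i ∈ Finset.range n, ξ i ⁻¹' {s i} := by
    ext ω
    simp [pre]
  have hmul := h.indep.measure_inter_preimage_eq_mul (Finset.range n) (sets := fun i => {s i})
    fun i _ => measurableSet_singleton _
  rw [e, Measure.real, hmul, ENNReal.toReal_prod]
  have : ∀ i ∈ Finset.range n, (μ (ξ i ⁻¹' {s i})).toReal = letterProb p (s i) :=
    fun i _ => h.prob_letter i (s i)
  rw [Finset.prod_congr rfl this]
  clear e hmul this
  induction n with
  | zero => simp [pre, stringProb]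
  | succ n ih => rw [Finset.prod_range_succ, ih, pre_succ, stringProb_append]

theorem memLp_of_dependsOn (h : IsBernoulliString p μ ξ) {c : (ℕ → Bool) → ℝ} {n : ℕ}
    (hc : DependsOn c (Set.Iio n)) (r : ENNReal) : MemLp (fun ω => c fun i => ξ i ω) r μ := by
  obtain ⟨C, hC⟩ := (Set.finite_range fun x : Finset.range n → Bool =>
    ‖c fun i => if hi : i ∈ Finset.range n then x ⟨i, hi⟩ else false‖).bddAbove
  refine MemLp.of_bound (h.measurable_of_dependsOn hc).aestronglyMeasurable C
    (Eventually.of_forall fun ω => ?_)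
  refine le_trans (le_of_eq ?_) (hC ⟨fun i => ξ i ω, rfl⟩)
  refine congrArg _ (hc fun i hi => ?_)
  have : i < n := hi
  simp [this]

theorem integrable_of_dependsOn (h : IsBernoulliString p μ ξ) {c : (ℕ → Bool) → ℝ} {n : ℕ}
    (hc : DependsOn c (Set.Iio n)) : Integrable (fun ω => c fun i => ξ i ω) μ :=
  (h.memLp_of_dependsOn hc 1).integrable le_rfl

theorem integral_mul_letter (h : IsBernoulliString p μ ξ) {c : (ℕ → Bool) → ℝ} {n : ℕ}
    (hc : DependsOn c (Set.Iio n)) (ψ : Bool → ℝ) :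
    ∫ ω, (c fun i => ξ i ω) * ψ (ξ n ω) ∂μ =
      (∫ ω, c fun i => ξ i ω ∂μ) * (p * ψ true + (1 - p) * ψ false) := by
  have hind := h.indep.indepFun_finset (Finset.range n) {n} (by simp) h.meas
  have e : (fun ω => c fun i => ξ i ω) = (fun x : Finset.range n → Bool =>
      c fun i => if hi : i ∈ Finset.range n then x ⟨i, hi⟩ else false) ∘
        fun ω (i : Finset.range n) => ξ i ω := by
    ext ω
    refine hc fun i hi => ?_
    have : i < n := hi
    simp [this]
  have e2 : (fun ω => ψ (ξ n ω)) =
      (fun x : ({n} : Finset ℕ) → Bool => ψ (x ⟨n, Finset.mem_singleton_self n⟩)) ∘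
        fun ω (i : ({n} : Finset ℕ)) => ξ i ω := rfl
  have hind2 : IndepFun (fun ω => c fun i => ξ i ω) (fun ω => ψ (ξ n ω)) μ := by
    rw [e, e2]
    exact hind.comp (measurable_of_finite _) (measurable_of_finite _)
  rw [← h.integral_letter n ψ]
  exact hind2.integral_fun_mul_eq_mul_integral
    (h.measurable_of_dependsOn hc).aestronglyMeasurable
    ((measurable_of_finite ψ).comp (h.meas n)).aestronglyMeasurable

/-- **Wald's second identity** for martingale transforms of the centered steps. -/
theorem integral_transform_sq (h : IsBernoulliString p μ ξ) {c : ℕ → (ℕ → Bool) → ℝ}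
    (hc : ∀ n, DependsOn (c n) (Set.Iio n)) {ψ : Bool → ℝ}
    (hψ : p * ψ true + (1 - p) * ψ false = 0) (N : ℕ) :
    ∫ ω, (∑ n ∈ Finset.range N, c n (fun i => ξ i ω) * ψ (ξ n ω)) ^ 2 ∂μ =
      (p * ψ true ^ 2 + (1 - p) * ψ false ^ 2) *
        ∫ ω, ∑ n ∈ Finset.range N, c n (fun i => ξ i ω) ^ 2 ∂μ := by
  have hM : ∀ N, DependsOn (fun s : ℕ → Bool => ∑ n ∈ Finset.range N, c n s * ψ (s n))
      (Set.Iio N) := by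
    intro N s s' hs
    refine Finset.sum_congr rfl fun n hn => ?_
    have hn' : n < N := Finset.mem_range.1 hn
    rw [hc n fun i hi => hs i (lt_trans hi hn'), hs n hn']
  have hC : ∀ N, DependsOn (fun s : ℕ → Bool => ∑ n ∈ Finset.range N, c n s ^ 2)
      (Set.Iio N) := by
    intro N s s' hs
    refine Finset.sum_congr rfl fun n hn => ?_
    have hn' : n < N := Finset.mem_range.1 hn
    rw [hc n fun i hi => hs i (lt_trans hi hn')]
  induction N with
  | zero => simp
  | succ N ih =>
    set M : (ℕ → Bool) → ℝ := fun s => ∑ n ∈ Finset.range N, c n s * ψ (s n) with hMdef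
    have d0 : DependsOn (fun s => M s ^ 2) (Set.Iio N) := fun s s' hs => by
      simp only [hMdef, hM N hs]
    have d1 : DependsOn (fun s => 2 * M s * c N s) (Set.Iio N) := fun s s' hs => by
      simp only [hMdef, hM N hs, hc N hs]
    have d2 : DependsOn (fun s => c N s ^ 2) (Set.Iio N) := fun s s' hs => by
      simp only [hc N hs]
    have hlift : ∀ {v : (ℕ → Bool) → ℝ}, DependsOn v (Set.Iio N) → ∀ φ : Bool → ℝ,
        Integrable (fun ω => (v fun i => ξ i ω) * φ (ξ N ω)) μ := fun {v} hv φ =>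
      h.integrable_of_dependsOn (c := fun s => v s * φ (s N)) (n := N + 1) fun s s' hs => by
        simp only
        rw [hv fun i hi => hs i (lt_trans hi (Nat.lt_succ_self N)), hs N (Nat.lt_succ_self N)]
    -- The coefficient of the cross term depends on the first `N` letters only and `ψ` is centered,
    -- so this term has mean zero.
    have e : ∀ ω, (∑ n ∈ Finset.range (N + 1), c n (fun i => ξ i ω) * ψ (ξ n ω)) ^ 2 =
        (M fun i => ξ i ω) ^ 2 +
          (2 * (M fun i => ξ i ω) * (c N fun i => ξ i ω)) * ψ (ξ N ω) +
          (c N fun i => ξ i ω) ^ 2 * ψ (ξ N ω) ^ 2 := by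
      intro ω
      rw [Finset.sum_range_succ]
      simp only [hMdef]
      ring
    simp only [e]
    have i0 := h.integrable_of_dependsOn d0
    have i1 := hlift d1 ψ
    have i2 := hlift d2 fun b => ψ b ^ 2
    have i01 : Integrable (fun ω => (M fun i => ξ i ω) ^ 2 +
        (2 * (M fun i => ξ i ω) * (c N fun i => ξ i ω)) * ψ (ξ N ω)) μ := i0.add i1
    rw [integral_add i01 i2, integral_add i0 i1, h.integral_mul_letter d1 ψ, hψ,
      h.integral_mul_letter d2 fun b => ψ b ^ 2, ih]
    simp only [Finset.sum_range_succ]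
    rw [integral_add (h.integrable_of_dependsOn (hC N)) (h.integrable_of_dependsOn d2)]
    ring

/-- The mean depth of a leaf is the mean first passage time. -/
theorem integral_nu (h : IsBernoulliString p μ ξ) (h0 : 0 < p) (h1 : p < 1) (t : ℝ) :
    ∫ ω, (nu p t fun i => ξ i ω : ℝ) ∂μ = meanDepth p t := by
  have hfin := leaves_finite h0 h1 (Real.exp_pos (-t))
  have hA : ∀ α : List Bool, MeasurableSet {ω | pre (fun i => ξ i ω) α.length = α} := by
    intro α
    have e : {ω | pre (fun i => ξ i ω) α.length = α} =
        (fun ω (i : Fin α.length) => ξ i ω) ⁻¹' {x | List.ofFn x = α} := by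
      ext ω
      have : pre (fun i => ξ i ω) α.length = List.ofFn fun i : Fin α.length => ξ i ω := by
        refine List.ext_getElem (by simp [pre]) fun i h1 h2 => ?_
        simp [pre]
      simp [this]
    rw [e]
    exact measurable_pi_lambda _ (fun i : Fin α.length => h.meas i)
      (Set.toFinite _).measurableSet
  -- Exactly one leaf is a prefix of the string, namely the one of length `ν`.
  have e : ∀ ω, (nu p t fun i => ξ i ω : ℝ) = ∑ α ∈ hfin.toFinset,
      {ω | pre (fun i => ξ i ω) α.length = α}.indicator (fun _ => (α.length : ℝ)) ω := by
    intro ω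
    set s : ℕ → Bool := fun i => ξ i ω with hs
    have hlen : ∀ n, (pre s n).length = n := fun n => by simp [pre]
    rw [Finset.sum_eq_single (pre s (nu p t s))]
    · rw [Set.indicator_of_mem]
      · rw [hlen]
      · simp [hlen, ← hs]
    · intro α hα hne
      refine Set.indicator_of_notMem (fun hmem => hne ?_) _
      have hmem' : pre s α.length = α := hmem
      rw [Set.Finite.mem_toFinset, ← hmem', pre_mem_leaves_iff h0 h1] at hα
      rw [← hα, hmem']
    · intro hn
      refine absurd ?_ hn
      rw [Set.Finite.mem_toFinset, pre_mem_leaves_iff h0 h1]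
  simp only [e]
  rw [integral_finsetSum _ fun α _ => (integrable_const _).indicator (hA α), meanDepth, leafSum,
    finsum_mem_eq_finite_toFinset_sum _ hfin]
  refine Finset.sum_congr rfl fun α _ => ?_
  have hα : pre (fun i => α.getD i false) α.length = α := by
    refine List.ext_getElem (by simp [pre]) fun i h1 h2 => ?_
    simp [pre, h2]
  have := h.prob_pre (fun i => α.getD i false) α.length
  rw [hα] at this
  rw [integral_indicator_const _ (hA α), this, smul_eq_mul]

end IsBernoulliString

/-! ### Law of large numbers and Wald identities for the first passage time -/

theorem partialSum_le_mul_maxStep (p : ℝ) (s : ℕ → Bool) (n : ℕ) :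
    partialSum p s n ≤ n * maxStep p := by
  rw [partialSum_eq_sum, ← nsmul_eq_mul]
  simpa using Finset.sum_le_card_nsmul (Finset.range n) (fun i => letterStep p (s i)) (maxStep p)
    fun i _ => le_maxStep p (s i)

theorem tendsto_nu_atTop (h0 : 0 < p) (h1 : p < 1) (s : ℕ → Bool) :
    Tendsto (fun t => nu p t s) atTop atTop := by
  refine tendsto_atTop.2 fun n => ?_
  filter_upwards [eventually_ge_atTop (n * maxStep p)] with t ht
  by_contra! hlt
  have h2 := nu_spec h0 h1 t s
  have h3 := partialSum_le_mul_maxStep p s (nu p t s)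
  have h4 : (nu p t s : ℝ) ≤ n := by exact_mod_cast hlt.le
  have h5 := mul_le_mul_of_nonneg_right h4 (maxStep_pos h0 h1).le
  linarith

/-- A pathwise inversion: `S_ν / ν → H`, and the bounded overshoot lets `t` replace `S_ν`. -/
theorem tendsto_nu_div (h0 : 0 < p) (h1 : p < 1) (s : ℕ → Bool) {H : ℝ} (hH : 0 < H)
    (hs : Tendsto (fun n : ℕ => partialSum p s n / n) atTop (𝓝 H)) :
    Tendsto (fun t => (nu p t s : ℝ) / t) atTop (𝓝 (1 / H)) := by
  have hnu := tendsto_nu_atTop h0 h1 s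
  have hdiff : Tendsto (fun t => partialSum p s (nu p t s) / (nu p t s : ℝ) -
      t / (nu p t s : ℝ)) atTop (𝓝 0) := by
    have hc : Tendsto (fun t => maxStep p / (nu p t s : ℝ)) atTop (𝓝 0) :=
      (tendsto_natCast_atTop_atTop.comp hnu).const_div_atTop _
    refine squeeze_zero' (Eventually.of_forall fun t => ?_) ?_ hc
    · rw [← sub_div]
      exact div_nonneg (by linarith [nu_spec h0 h1 t s]) (Nat.cast_nonneg _)
    · filter_upwards [eventually_ge_atTop 0] with t ht
      rw [← sub_div]
      exact div_le_div_of_nonneg_right (by linarith [partialSum_nu_le h0 h1 ht s])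
        (Nat.cast_nonneg _)
  have hlim := (hs.comp hnu).sub hdiff
  rw [sub_zero] at hlim
  have hinv := hlim.inv₀ hH.ne'
  rw [one_div]
  refine hinv.congr fun t => ?_
  simp [Function.comp]

/-- Every first passage time is determined by finitely many letters. -/
theorem dependsOn_nu (h0 : 0 < p) (h1 : p < 1) {t : ℝ} {N : ℕ} (hN : ∀ s, nu p t s ≤ N) :
    DependsOn (fun s => nu p t s) (Set.Iio N) := by
  intro s s' hs
  have key : ∀ i, i < nu p t s ↔ i < nu p t s' := by
    intro i
    rcases lt_or_ge i N with hi | hi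
    · have : partialSum p s i = partialSum p s' i := by
        rw [partialSum_eq_sum, partialSum_eq_sum]
        refine Finset.sum_congr rfl fun j hj => ?_
        rw [hs j (lt_trans (Finset.mem_range.1 hj) hi)]
      rw [lt_nu_iff h0 h1, lt_nu_iff h0 h1, this]
    · exact iff_of_false (not_lt.2 ((hN s).trans hi)) (not_lt.2 ((hN s').trans hi))
  exact le_antisymm (not_lt.1 fun h => lt_irrefl _ ((key _).1 h))
    (not_lt.1 fun h => lt_irrefl _ ((key _).2 h))

theorem dependsOn_partialSum_nu (h0 : 0 < p) (h1 : p < 1) {t : ℝ} {N : ℕ}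
    (hN : ∀ s, nu p t s ≤ N) :
    DependsOn (fun s => partialSum p s (nu p t s)) (Set.Iio N) := by
  intro s s' hs
  have h : nu p t s = nu p t s' := dependsOn_nu h0 h1 hN hs
  simp only
  rw [← h, partialSum_eq_sum, partialSum_eq_sum]
  refine Finset.sum_congr rfl fun j hj => ?_
  rw [hs j (lt_of_lt_of_le (Finset.mem_range.1 hj) (hN s))]

theorem exists_nu_le (h0 : 0 < p) (h1 : p < 1) {t : ℝ} (ht : 0 ≤ t) :
    ∃ N : ℕ, ∀ s, nu p t s ≤ N := by
  obtain ⟨N, hN⟩ := exists_nat_ge ((t + maxStep p) / minStep p)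
  exact ⟨N, fun s => by exact_mod_cast (nu_le h0 h1 ht s).trans hN⟩

theorem mean_letterStep (p : ℝ) :
    p * (letterStep p true - Real.binEntropy p) +
      (1 - p) * (letterStep p false - Real.binEntropy p) = 0 := by
  simp only [letterStep, letterProb, if_true, Bool.false_eq_true, if_false]
  linear_combination -binEntropy_eq p

theorem variance_letterStep (p : ℝ) :
    p * (letterStep p true - Real.binEntropy p) ^ 2 +
      (1 - p) * (letterStep p false - Real.binEntropy p) ^ 2 = sigmaSq p := by
  simp only [letterStep, letterProb, if_true, Bool.false_eq_true, if_false, sigmaSq, secondMoment]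
  linear_combination 2 * Real.binEntropy p * binEntropy_eq p

theorem sum_centered (p : ℝ) (s : ℕ → Bool) (n : ℕ) :
    ∑ i ∈ Finset.range n, (letterStep p (s i) - Real.binEntropy p) =
      partialSum p s n - n * Real.binEntropy p := by
  rw [Finset.sum_sub_distrib, partialSum_eq_sum]
  simp

theorem sum_range_ite_lt {M : Type*} [AddCommMonoid M] (f : ℕ → M) {n N : ℕ} (h : n ≤ N) :
    ∑ i ∈ Finset.range N, (if i < n then f i else 0) = ∑ i ∈ Finset.range n, f i := by
  rw [← Finset.sum_filter]
  congr 1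
  ext i
  simp only [Finset.mem_filter, Finset.mem_range]
  omega

/-- The difference of the indicators is `±1` exactly between `m` and `n`. Through Wald's identity
this turns a squared increment into `|ν - m|`. -/
theorem sum_range_sq_sub_ite {m n N : ℕ} (hm : m ≤ N) (hn : n ≤ N) :
    ∑ i ∈ Finset.range N, ((if i < n then (1 : ℝ) else 0) - if i < m then 1 else 0) ^ 2 =
      |(n : ℝ) - m| := by
  have e : ∀ i, ((if i < n then (1 : ℝ) else 0) - if i < m then 1 else 0) ^ 2 =
      (if i < n then 1 else 0) + (if i < m then 1 else 0) -
        2 * if i < min n m then 1 else 0 := by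
    intro i
    by_cases h1 : i < n <;> by_cases h2 : i < m <;> (simp [h1, h2]; try norm_num)
  simp only [e]
  rw [Finset.sum_sub_distrib, Finset.sum_add_distrib, ← Finset.mul_sum, sum_range_ite_lt _ hn,
    sum_range_ite_lt _ hm, sum_range_ite_lt _ ((min_le_left n m).trans hn)]
  simp only [Finset.sum_const, Finset.card_range, nsmul_eq_mul, mul_one, Nat.cast_min]
  rcases le_total (n : ℝ) m with h | h
  · rw [min_eq_left h, abs_of_nonpos (by linarith)]; ring
  · rw [min_eq_right h, abs_of_nonneg (by linarith)]; ring

theorem dependsOn_ite_partialSum (p t : ℝ) (n : ℕ) :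
    DependsOn (fun s => if partialSum p s n ≤ t then (1 : ℝ) else 0) (Set.Iio n) := by
  intro s s' hs
  have : partialSum p s n = partialSum p s' n := by
    rw [partialSum_eq_sum, partialSum_eq_sum]
    refine Finset.sum_congr rfl fun j hj => ?_
    rw [hs j (Finset.mem_range.1 hj)]
  simp only [this]

namespace IsBernoulliString

variable {Ω : Type*} [MeasurableSpace Ω] {μ : Measure Ω} [IsProbabilityMeasure μ]
  {ξ : ℕ → Ω → Bool}

/-- Second moment of the increment of the centered walk between a fixed time and the first
passage time. -/
theorem integral_sq_stopped_sub (h : IsBernoulliString p μ ξ) (h0 : 0 < p) (h1 : p < 1) {t : ℝ}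
    (ht : 0 ≤ t) (m : ℕ) :
    ∫ ω, ((partialSum p (fun i => ξ i ω) (nu p t fun i => ξ i ω) -
        (nu p t fun i => ξ i ω) * Real.binEntropy p) -
        (partialSum p (fun i => ξ i ω) m - m * Real.binEntropy p)) ^ 2 ∂μ =
      sigmaSq p * ∫ ω, |((nu p t fun i => ξ i ω : ℕ) : ℝ) - m| ∂μ := by
  obtain ⟨N, hN⟩ := exists_nu_le h0 h1 ht
  have key := h.integral_transform_sq
    (ψ := fun b => letterStep p b - Real.binEntropy p)
    -- These are the indicators of `n < ν` and `n < m`; the transform is the difference of the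
    -- centered walk stopped at `ν` and at `m`.
    (c := fun n s => (if partialSum p s n ≤ t then (1 : ℝ) else 0) - if n < m then 1 else 0)
    (fun n s s' hs => by
      have := dependsOn_ite_partialSum p t n hs
      simp only at this ⊢
      rw [this]) (mean_letterStep p) (max N m)
  simp only [variance_letterStep p, ← lt_nu_iff h0 h1] at key
  convert key using 4 with ω ω
  · rw [← sum_centered, ← sum_centered,
      ← sum_range_ite_lt _ ((hN fun i => ξ i ω).trans (le_max_left N m)),
      ← sum_range_ite_lt _ (le_max_right N m), ← Finset.sum_sub_distrib]
    refine Finset.sum_congr rfl fun i _ => ?_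
    rw [sub_mul, ite_mul, ite_mul, one_mul, zero_mul]
  · exact (sum_range_sq_sub_ite (le_max_right N m)
      ((hN fun i => ξ i ω).trans (le_max_left N m))).symm

theorem integral_sq_walk (h : IsBernoulliString p μ ξ) (m : ℕ) :
    ∫ ω, (partialSum p (fun i => ξ i ω) m - m * Real.binEntropy p) ^ 2 ∂μ = sigmaSq p * m := by
  have key := h.integral_transform_sq (ψ := fun b => letterStep p b - Real.binEntropy p)
    (c := fun _ _ => 1) (fun n s s' _ => rfl)
    (mean_letterStep p) m
  simp only [variance_letterStep p, one_mul, one_pow, Finset.sum_const, Finset.card_range,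
    nsmul_eq_mul, mul_one, integral_const, probReal_univ, smul_eq_mul] at key
  rw [← key]
  congr with ω
  rw [← sum_centered]

theorem memLp_nu (h : IsBernoulliString p μ ξ) (h0 : 0 < p) (h1 : p < 1) {t : ℝ}
    (ht : 0 ≤ t) (r : ENNReal) : MemLp (fun ω => (nu p t fun i => ξ i ω : ℝ)) r μ := by
  obtain ⟨N, hN⟩ := exists_nu_le h0 h1 ht
  exact h.memLp_of_dependsOn (c := fun s => (nu p t s : ℝ))
    (fun s s' hs => congrArg _ (dependsOn_nu h0 h1 hN hs)) r

theorem memLp_partialSum_nu (h : IsBernoulliString p μ ξ) (h0 : 0 < p) (h1 : p < 1) {t : ℝ}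
    (ht : 0 ≤ t) (r : ENNReal) :
    MemLp (fun ω => partialSum p (fun i => ξ i ω) (nu p t fun i => ξ i ω)) r μ := by
  obtain ⟨N, hN⟩ := exists_nu_le h0 h1 ht
  exact h.memLp_of_dependsOn (dependsOn_partialSum_nu h0 h1 hN) r

theorem memLp_partialSum (h : IsBernoulliString p μ ξ) (n : ℕ) (r : ENNReal) :
    MemLp (fun ω => partialSum p (fun i => ξ i ω) n) r μ :=
  h.memLp_of_dependsOn (c := fun s => partialSum p s n) (n := n) (fun s s' hs => by
    simp only [partialSum_eq_sum]
    refine Finset.sum_congr rfl fun j hj => ?_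
    rw [hs j (Finset.mem_range.1 hj)]) r

theorem integral_sq_stopped (h : IsBernoulliString p μ ξ) (h0 : 0 < p) (h1 : p < 1) {t : ℝ}
    (ht : 0 ≤ t) :
    ∫ ω, (partialSum p (fun i => ξ i ω) (nu p t fun i => ξ i ω) -
        (nu p t fun i => ξ i ω) * Real.binEntropy p) ^ 2 ∂μ = sigmaSq p * meanDepth p t := by
  have := h.integral_sq_stopped_sub h0 h1 ht 0
  rw [← h.integral_nu h0 h1 t]
  simpa [partialSum] using this

theorem identDistrib (h : IsBernoulliString p μ ξ) (i : ℕ) : IdentDistrib (ξ i) (ξ 0) μ μ where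
  aemeasurable_fst := (h.meas i).aemeasurable
  aemeasurable_snd := (h.meas 0).aemeasurable
  map_eq := by
    refine Measure.ext_of_singleton fun b => ?_
    rw [Measure.map_apply (h.meas i) (measurableSet_singleton b),
      Measure.map_apply (h.meas 0) (measurableSet_singleton b)]
    have := (h.prob_letter i b).trans (h.prob_letter 0 b).symm
    exact (ENNReal.toReal_eq_toReal_iff' (measure_ne_top _ _) (measure_ne_top _ _)).1 this

theorem integral_letterStep (h : IsBernoulliString p μ ξ) (i : ℕ) :
    ∫ ω, letterStep p (ξ i ω) ∂μ = Real.binEntropy p := by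
  rw [h.integral_letter i, binEntropy_eq]
  simp [letterStep, letterProb]

theorem memLp_letterStep (h : IsBernoulliString p μ ξ) (i : ℕ) (r : ENNReal) :
    MemLp (fun ω => letterStep p (ξ i ω)) r μ :=
  h.memLp_of_dependsOn (c := fun s => letterStep p (s i)) (n := i + 1)
    (fun s s' hs => by simp only [hs i (Nat.lt_succ_self i)]) r

theorem ae_tendsto_nu_div (h : IsBernoulliString p μ ξ) (h0 : 0 < p) (h1 : p < 1) :
    ∀ᵐ ω ∂μ, Tendsto (fun t => (nu p t fun i => ξ i ω : ℝ) / t) atTop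
      (𝓝 (1 / Real.binEntropy p)) := by
  have hind : iIndepFun (fun i ω => letterStep p (ξ i ω)) μ :=
    h.indep.comp (fun _ => letterStep p) fun _ => measurable_of_finite _
  have := strong_law_ae_real (fun i ω => letterStep p (ξ i ω))
    ((h.memLp_letterStep 0 1).integrable le_rfl) (fun i j hij => hind.indepFun hij)
    fun i => (h.identDistrib i).comp (measurable_of_finite (letterStep p))
  filter_upwards [this] with ω hω
  rw [h.integral_letterStep] at hω
  exact tendsto_nu_div h0 h1 _ (Real.binEntropy_pos h0 h1) hω

end IsBernoulliString

/-! ### Second moments and the variance -/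

theorem integral_abs_le_sqrt {Ω : Type*} [MeasurableSpace Ω] {μ : Measure Ω}
    [IsProbabilityMeasure μ] {X : Ω → ℝ} (hX : MemLp X 2 μ) :
    ∫ ω, |X ω| ∂μ ≤ √(∫ ω, X ω ^ 2 ∂μ) := by
  refine Real.le_sqrt_of_sq_le ?_
  have h1 := variance_eq_sub (μ := μ) (X := fun ω => |X ω|) hX.abs
  have h2 := variance_nonneg (fun ω => |X ω|) μ
  simp only [Pi.pow_apply, sq_abs] at h1
  linarith

theorem tendstoInMeasure_zero_of_integral_sq {Ω ι : Type*} [MeasurableSpace Ω] {μ : Measure Ω}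
    [IsProbabilityMeasure μ] {l : Filter ι} {X : ι → Ω → ℝ} (hX : ∀ᶠ i in l, MemLp (X i) 2 μ)
    (h : Tendsto (fun i => ∫ ω, X i ω ^ 2 ∂μ) l (𝓝 0)) : TendstoInMeasure μ X l 0 := by
  rw [tendstoInMeasure_iff_measureReal_norm]
  intro ε hε
  have h2 := h.div_const (ε ^ 2)
  rw [zero_div] at h2
  refine squeeze_zero' (Eventually.of_forall fun i => measureReal_nonneg) ?_ h2
  filter_upwards [hX] with i hi
  rw [le_div_iff₀ (by positivity), mul_comm]
  have e : {ω | ε ≤ ‖X i ω - (0 : Ω → ℝ) ω‖} = {ω | ε ^ 2 ≤ X i ω ^ 2} := by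
    ext ω
    simp only [Set.mem_ofPred_eq, Pi.zero_apply, sub_zero, Real.norm_eq_abs]
    rw [← sq_abs (X i ω), pow_le_pow_iff_left₀ hε.le (abs_nonneg _) two_ne_zero]
  rw [e]
  exact mul_meas_ge_le_integral_of_nonneg (Eventually.of_forall fun ω => sq_nonneg _)
    hi.integrable_sq _

/-- Boundedness of the renewal solution gives `E ν = t / H + O(1)`, with no distinction between
rational and irrational ratios. -/
theorem exists_meanDepth_bound (h0 : 0 < p) (h1 : p < 1) :
    ∃ K, 0 ≤ K ∧ ∀ t, 0 ≤ t → |Real.binEntropy p * meanDepth p t - t| ≤ K := by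
  have hs := renewalSolution_meanDepth h0 h1
  obtain ⟨K, hK⟩ := hs.bdd
  exact ⟨K, (abs_nonneg _).trans (hK _ le_rfl),
    fun t ht => hK t (by linarith [le_max_left (-Real.log p) (-Real.log (1 - p)), hs.ha])⟩

theorem exists_meanDepth_le (h0 : 0 < p) (h1 : p < 1) :
    ∃ C, 0 ≤ C ∧ ∀ t, 1 ≤ t → meanDepth p t ≤ C * t := by
  obtain ⟨K, hK0, hK⟩ := exists_meanDepth_bound h0 h1
  have hH := Real.binEntropy_pos h0 h1
  refine ⟨(K + 1) / Real.binEntropy p, by positivity, fun t ht => ?_⟩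
  have := (abs_le.1 (hK t (by linarith))).2
  rw [div_mul_eq_mul_div, le_div_iff₀ hH]
  nlinarith

theorem sigmaSq_eq (h0 : 0 < p) (h1 : p < 1) :
    sigmaSq p = p * (1 - p) * Real.log (p / (1 - p)) ^ 2 := by
  rw [Real.log_div h0.ne' (by linarith), sigmaSq, secondMoment, binEntropy_eq]
  ring

theorem sigmaSq_nonneg (h0 : 0 < p) (h1 : p < 1) : 0 ≤ sigmaSq p := by
  rw [sigmaSq_eq h0 h1]
  have : 0 < 1 - p := by linarith
  positivity

theorem sigmaSq_pos (h0 : 0 < p) (h1 : p < 1) (hp : p ≠ 1 / 2) : 0 < sigmaSq p := by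
  rw [sigmaSq_eq h0 h1]
  have hq : 0 < 1 - p := by linarith
  have : Real.log (p / (1 - p)) ≠ 0 := by
    refine Real.log_ne_zero_of_pos_of_ne_one (by positivity) fun h => hp ?_
    rw [div_eq_one_iff_eq hq.ne'] at h
    linarith
  positivity

theorem sigmaSq_half : sigmaSq (1 / 2) = 0 := by
  rw [sigmaSq_eq (by norm_num) (by norm_num)]
  norm_num

theorem nu_half (t : ℝ) (s s' : ℕ → Bool) : nu (1 / 2) t s = nu (1 / 2) t s' := by
  have h : ∀ b, letterProb (1 / 2) b = 1 / 2 := by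
    intro b
    cases b <;> norm_num [letterProb]
  simp only [nu, partialSum, h]

namespace IsBernoulliString

variable {Ω : Type*} [MeasurableSpace Ω] {μ : Measure Ω} [IsProbabilityMeasure μ]
  {ξ : ℕ → Ω → Bool}

/-- The second moment of the first passage time about `t / H`, up to the overshoot. -/
theorem abs_integral_sq_nu_sub (h : IsBernoulliString p μ ξ) (h0 : 0 < p) (h1 : p < 1) {t : ℝ}
    (ht : 0 ≤ t) :
    |∫ ω, (Real.binEntropy p * (nu p t fun i => ξ i ω) - t) ^ 2 ∂μ - sigmaSq p * meanDepth p t| ≤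
      2 * maxStep p * √(sigmaSq p * meanDepth p t) + maxStep p ^ 2 := by
  set H := Real.binEntropy p
  set c := maxStep p
  have hc : 0 < c := maxStep_pos h0 h1
  -- `B` is the overshoot and `W` the stopped centered walk, so `H ν - t = B - W`. `E W²` is known
  -- exactly, and the cross term is at most `c E|W|`.
  set B : Ω → ℝ := fun ω => partialSum p (fun i => ξ i ω) (nu p t fun i => ξ i ω) - t with hB
  set W : Ω → ℝ := fun ω => partialSum p (fun i => ξ i ω) (nu p t fun i => ξ i ω) -
    (nu p t fun i => ξ i ω) * H with hW
  have hSm := h.memLp_partialSum_nu h0 h1 ht 2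
  have hBm : MemLp B 2 μ := hSm.sub (memLp_const t)
  have hWm : MemLp W 2 μ := by
    have := hSm.sub ((h.memLp_nu h0 h1 ht 2).const_mul H)
    convert this using 1
    ext ω
    simp only [hW, Pi.sub_apply]
    ring
  have hBb : ∀ ω, |B ω| ≤ c := by
    intro ω
    have h1' := nu_spec h0 h1 t fun i => ξ i ω
    have h2' := partialSum_nu_le h0 h1 ht fun i => ξ i ω
    rw [abs_of_nonneg (by simp only [hB]; linarith)]
    simp only [hB]; linarith
  have hWW := h.integral_sq_stopped h0 h1 ht
  have i1 := hBm.integrable_sq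
  have i2 := hWm.integrable_sq
  have i3 : Integrable (fun ω => 2 * (B ω * W ω)) μ := (hBm.integrable_mul hWm).const_mul 2
  have e : ∫ ω, (H * (nu p t fun i => ξ i ω) - t) ^ 2 ∂μ =
      ∫ ω, B ω ^ 2 ∂μ - 2 * ∫ ω, B ω * W ω ∂μ + ∫ ω, W ω ^ 2 ∂μ := by
    have i12 : Integrable (fun ω => B ω ^ 2 - 2 * (B ω * W ω)) μ := i1.sub i3
    rw [← integral_const_mul, ← integral_sub i1 i3, ← integral_add i12 i2]
    congr with ω
    simp only [hB, hW]
    ring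
  have b1 : ∫ ω, B ω ^ 2 ∂μ ≤ c ^ 2 := by
    calc ∫ ω, B ω ^ 2 ∂μ ≤ ∫ _, c ^ 2 ∂μ :=
          integral_mono i1 (integrable_const _) fun ω => sq_le_sq' (abs_le.1 (hBb ω)).1
            (abs_le.1 (hBb ω)).2
      _ = c ^ 2 := by simp
  have b0 : 0 ≤ ∫ ω, B ω ^ 2 ∂μ := integral_nonneg fun ω => sq_nonneg _
  have b2 : |∫ ω, B ω * W ω ∂μ| ≤ c * √(∫ ω, W ω ^ 2 ∂μ) := by
    calc |∫ ω, B ω * W ω ∂μ| ≤ ∫ ω, |B ω * W ω| ∂μ := abs_integral_le_integral_abs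
      _ ≤ ∫ ω, c * |W ω| ∂μ := by
          refine integral_mono (hBm.integrable_mul hWm).abs
            ((hWm.integrable one_le_two).abs.const_mul c) fun ω => ?_
          simp only [abs_mul]
          exact mul_le_mul_of_nonneg_right (hBb ω) (abs_nonneg _)
      _ = c * ∫ ω, |W ω| ∂μ := integral_const_mul _ _
      _ ≤ _ := mul_le_mul_of_nonneg_left (integral_abs_le_sqrt hWm) hc.le
  rw [hWW] at b2
  rw [e, hWW]
  rw [abs_le] at b2 ⊢
  constructor <;> nlinarith [b2.1, b2.2, sq_nonneg c]

theorem exists_integral_sq_nu_le (h : IsBernoulliString p μ ξ) (h0 : 0 < p) (h1 : p < 1) :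
    ∃ C, 0 ≤ C ∧ ∀ t, 1 ≤ t →
      ∫ ω, (Real.binEntropy p * (nu p t fun i => ξ i ω) - t) ^ 2 ∂μ ≤ C * t := by
  obtain ⟨C, hC0, hC⟩ := exists_meanDepth_le h0 h1
  have hσ := sigmaSq_nonneg h0 h1
  refine ⟨2 * (sigmaSq p * C) + 2 * maxStep p ^ 2, by positivity, fun t ht => ?_⟩
  have hV : 0 ≤ meanDepth p t := by
    rw [← h.integral_nu h0 h1]
    exact integral_nonneg fun ω => Nat.cast_nonneg _
  have hb := (abs_le.1 (h.abs_integral_sq_nu_sub h0 h1 (by linarith : (0 : ℝ) ≤ t))).2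
  have hs := Real.sq_sqrt (mul_nonneg hσ hV)
  have hCt := mul_le_mul_of_nonneg_left (hC t ht) hσ
  nlinarith [sq_nonneg (maxStep p - √(sigmaSq p * meanDepth p t)), sq_nonneg (maxStep p)]

theorem variance_nu (h : IsBernoulliString p μ ξ) (h0 : 0 < p) (h1 : p < 1) {t : ℝ}
    (ht : 0 ≤ t) :
    Real.binEntropy p ^ 2 * Var[fun ω => (nu p t fun i => ξ i ω : ℝ); μ] =
      ∫ ω, (Real.binEntropy p * (nu p t fun i => ξ i ω) - t) ^ 2 ∂μ -
        (Real.binEntropy p * meanDepth p t - t) ^ 2 := by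
  have hm := h.memLp_nu h0 h1 ht 2
  have hm' : MemLp (fun ω => Real.binEntropy p * (nu p t fun i => ξ i ω : ℝ) - t) 2 μ :=
    (hm.const_mul _).sub (memLp_const t)
  rw [← variance_const_mul, ← variance_sub_const (hm.const_mul _).aestronglyMeasurable t,
    variance_eq_sub hm', integral_sub ((hm.integrable one_le_two).const_mul _)
      (integrable_const t), integral_const_mul, h.integral_nu h0 h1]
  simp

/-- `H² Var ν` is `E (H ν - t)²` minus the square of the bounded bias `H V - t`. The former is `σ² V
+ O(√t)` with `V = t / H + O(1)`, so the total error is `O(√t)`. -/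
theorem isEquivalent_variance_nu (h : IsBernoulliString p μ ξ) (h0 : 0 < p) (h1 : p < 1) :
    (fun t => Var[fun ω => (nu p t fun i => ξ i ω : ℝ); μ]) ~[atTop]
      fun t => sigmaSq p / Real.binEntropy p ^ 3 * t := by
  have hH := Real.binEntropy_pos h0 h1
  by_cases hp : p = 1 / 2
  · subst hp
    rw [sigmaSq_half]
    simp only [zero_div, zero_mul]
    -- Equivalence to zero demands a variance that vanishes, and for `p = 1 / 2` the equal steps
    -- make `ν` deterministic.
    refine (isEquivalent_zero_iff_eventually_zero).2 (Eventually.of_forall fun t => ?_)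
    have : (fun ω => (nu (1 / 2) t fun i => ξ i ω : ℝ)) =
        fun _ => (nu (1 / 2) t fun _ => true : ℝ) := by
      ext ω
      rw [nu_half t (fun i => ξ i ω) fun _ => true]
    simp only [this]
    simp [variance_eq_integral, aemeasurable_const]
  have hσ := sigmaSq_pos h0 h1 hp
  have hκ : sigmaSq p / Real.binEntropy p ^ 3 ≠ 0 := by positivity
  refine (isLittleO_const_mul_right_iff hκ).2 ?_
  obtain ⟨C, hC0, hC⟩ := exists_meanDepth_le h0 h1
  obtain ⟨K, hK0, hK⟩ := exists_meanDepth_bound h0 h1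
  have hsqrt : (fun t : ℝ => √t) =o[atTop] fun t : ℝ => t := by
    refine isLittleO_of_tendsto' ((eventually_gt_atTop 0).mono fun t ht h => absurd h ht.ne') ?_
    have := tendsto_inv_atTop_zero.comp Real.tendsto_sqrt_atTop
    refine this.congr' ((eventually_gt_atTop 0).mono fun t ht => ?_)
    simp only [Function.comp, Real.sqrt_div_self', one_div]
  refine IsBigO.trans_isLittleO (IsBigO.of_bound
    ((2 * maxStep p * √(sigmaSq p * C) + maxStep p ^ 2 + K ^ 2) / Real.binEntropy p ^ 2 +
      sigmaSq p / Real.binEntropy p ^ 3 * K) ?_) hsqrt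
  filter_upwards [eventually_ge_atTop 1] with t ht
  have ht0 : 0 ≤ t := by linarith
  have hst : 1 ≤ √t := Real.one_le_sqrt.2 ht
  have hc := maxStep_pos h0 h1
  set V := meanDepth p t
  set Z2 := ∫ ω, (Real.binEntropy p * (nu p t fun i => ξ i ω) - t) ^ 2 ∂μ with hZ2
  set H := Real.binEntropy p
  have hvar : Var[fun ω => (nu p t fun i => ξ i ω : ℝ); μ] = (Z2 - (H * V - t) ^ 2) / H ^ 2 := by
    rw [eq_div_iff (by positivity), mul_comm]
    exact h.variance_nu h0 h1 ht0
  have e : Var[fun ω => (nu p t fun i => ξ i ω : ℝ); μ] - sigmaSq p / H ^ 3 * t =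
      ((Z2 - sigmaSq p * V) - (H * V - t) ^ 2) / H ^ 2 + sigmaSq p / H ^ 3 * (H * V - t) := by
    rw [hvar]
    field_simp
    ring
  have b1 := h.abs_integral_sq_nu_sub h0 h1 ht0
  have b2 := hK t ht0
  have b3 : √(sigmaSq p * V) ≤ √(sigmaSq p * C) * √t := by
    rw [← Real.sqrt_mul (by positivity)]
    refine Real.sqrt_le_sqrt ?_
    rw [mul_assoc]
    exact mul_le_mul_of_nonneg_left (hC t ht) hσ.le
  have b4 : (H * V - t) ^ 2 ≤ K ^ 2 := sq_le_sq' (abs_le.1 b2).1 (abs_le.1 b2).2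
  have b5 : |(Z2 - sigmaSq p * V) - (H * V - t) ^ 2| ≤
      (2 * maxStep p * √(sigmaSq p * C) + maxStep p ^ 2 + K ^ 2) * √t := by
    have c1 : |(Z2 - sigmaSq p * V) - (H * V - t) ^ 2| ≤ |Z2 - sigmaSq p * V| + (H * V - t) ^ 2 :=
      (abs_sub _ _).trans_eq (by rw [abs_of_nonneg (sq_nonneg (H * V - t))])
    have c2 : 2 * maxStep p * √(sigmaSq p * V) ≤ 2 * maxStep p * (√(sigmaSq p * C) * √t) := by
      gcongr
    have c3 : maxStep p ^ 2 + K ^ 2 ≤ (maxStep p ^ 2 + K ^ 2) * √t :=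
      le_mul_of_one_le_right (by positivity) hst
    linarith
  show ‖Var[fun ω => (nu p t fun i => ξ i ω : ℝ); μ] - sigmaSq p / H ^ 3 * t‖ ≤ _
  rw [e, Real.norm_eq_abs, Real.norm_eq_abs, abs_of_nonneg (Real.sqrt_nonneg t), add_mul]
  refine (abs_add_le _ _).trans (add_le_add ?_ ?_)
  · rw [abs_div, abs_of_pos (show 0 < H ^ 2 by positivity), div_mul_eq_mul_div]
    gcongr
  · rw [abs_mul, abs_of_pos (show 0 < sigmaSq p / H ^ 3 by positivity), mul_assoc]
    gcongr
    exact b2.trans (le_mul_of_one_le_right hK0 hst)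

end IsBernoulliString

/-! ### The central limit theorem -/

namespace IsBernoulliString

variable {Ω : Type*} [MeasurableSpace Ω] {μ : Measure Ω} [IsProbabilityMeasure μ]
  {ξ : ℕ → Ω → Bool}

/-- The central limit theorem for the walk. -/
theorem tendstoInDistribution_walk (h : IsBernoulliString p μ ξ) {Ω' : Type*}
    [MeasurableSpace Ω'] {P : Measure Ω'} [IsProbabilityMeasure P] {Y : Ω' → ℝ}
    (hY : HasLaw Y (gaussianReal 0 (sigmaSq p).toNNReal) P) :
    TendstoInDistribution (fun (n : ℕ) ω => (√n)⁻¹ *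
      (partialSum p (fun i => ξ i ω) n - n * Real.binEntropy p)) atTop Y (fun _ => μ) P := by
  have hvar : Var[fun ω => letterStep p (ξ 0 ω); μ] = sigmaSq p := by
    rw [variance_eq_integral (h.memLp_letterStep 0 1).aestronglyMeasurable.aemeasurable,
      h.integral_letterStep, ← variance_letterStep]
    exact h.integral_letter 0 fun b => (letterStep p b - Real.binEntropy p) ^ 2
  rw [← hvar] at hY
  have := tendstoInDistribution_inv_sqrt_mul_sum_sub (X := fun i ω => letterStep p (ξ i ω)) hY
    (h.memLp_letterStep 0 2) (h.indep.comp (fun _ => letterStep p) fun _ => measurable_of_finite _)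
    fun i => (h.identDistrib i).comp (measurable_of_finite (letterStep p))
  rw [h.integral_letterStep] at this
  exact this

theorem memLp_walk (h : IsBernoulliString p μ ξ) (n : ℕ) (r : ENNReal) :
    MemLp (fun ω => partialSum p (fun i => ξ i ω) n - n * Real.binEntropy p) r μ :=
  (h.memLp_partialSum n r).sub (memLp_const _)

/-- The first passage time, normalized, is close to the normalized walk at time `⌊t / H⌋`. -/
theorem tendsto_integral_sq_sub_walk (h : IsBernoulliString p μ ξ) (h0 : 0 < p) (h1 : p < 1) :
    Tendsto (fun t : ℝ => ∫ ω, (((nu p t fun i => ξ i ω) - t / Real.binEntropy p) / √t -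
      -(1 / (Real.binEntropy p * √(Real.binEntropy p))) *
        ((√⌊(Real.binEntropy p)⁻¹ * t⌋₊)⁻¹ *
          (partialSum p (fun i => ξ i ω) ⌊(Real.binEntropy p)⁻¹ * t⌋₊ -
            ⌊(Real.binEntropy p)⁻¹ * t⌋₊ * Real.binEntropy p))) ^ 2 ∂μ) atTop (𝓝 0) := by
  have hH := Real.binEntropy_pos h0 h1
  have hσ := sigmaSq_nonneg h0 h1
  have hc := maxStep_pos h0 h1
  obtain ⟨C, hC0, hC⟩ := h.exists_integral_sq_nu_le h0 h1
  set H := Real.binEntropy p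
  set c := maxStep p
  set κ := 1 / (H * √H) with hκ
  set n : ℝ → ℕ := fun t => ⌊H⁻¹ * t⌋₊ with hn
  have hbound : ∀ t : ℝ, 1 ≤ t → ∫ ω, (((nu p t fun i => ξ i ω) - t / H) / √t -
      -κ * ((√(n t))⁻¹ * (partialSum p (fun i => ξ i ω) (n t) - n t * H))) ^ 2 ∂μ ≤
      3 * (c ^ 2 / H ^ 2 * t⁻¹ + sigmaSq p / H ^ 2 * (√C / H * (√t)⁻¹ + t⁻¹) +
        sigmaSq p * (κ - 1 / H * √(n t / t)) ^ 2) := by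
    intro t ht
    have ht0 : 0 < t := by linarith
    have hst : 0 < √t := Real.sqrt_pos.2 ht0
    have hst2 : √t ^ 2 = t := Real.sq_sqrt ht0.le
    set B : Ω → ℝ := fun ω => partialSum p (fun i => ξ i ω) (nu p t fun i => ξ i ω) - t with hB
    set W : Ω → ℝ := fun ω => partialSum p (fun i => ξ i ω) (nu p t fun i => ξ i ω) -
      (nu p t fun i => ξ i ω) * H with hW
    set M : Ω → ℝ := fun ω => partialSum p (fun i => ξ i ω) (n t) - n t * H with hM
    have hSm := h.memLp_partialSum_nu h0 h1 ht0.le 2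
    have hBm : MemLp B 2 μ := hSm.sub (memLp_const t)
    have hνm := h.memLp_nu h0 h1 ht0.le 2
    have hWm : MemLp W 2 μ := by
      have := hSm.sub (hνm.const_mul H)
      convert this using 1
      ext ω
      simp only [hW, Pi.sub_apply]
      ring
    have hMm : MemLp M 2 μ := h.memLp_walk (n t) 2
    have hBb : ∀ ω, B ω ^ 2 ≤ c ^ 2 := by
      intro ω
      have h1' := nu_spec h0 h1 t fun i => ξ i ω
      have h2' := partialSum_nu_le h0 h1 ht0.le fun i => ξ i ω
      exact pow_le_pow_left₀ (by simp only [hB]; linarith) (by simp only [hB]; linarith) 2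
    -- The decisive estimate: by Wald's identity the left side is `σ² E|ν - n|`, of order `√t` only,
    -- so it vanishes after division by `t`.
    have hWM : ∫ ω, (W ω - M ω) ^ 2 ∂μ ≤ sigmaSq p * (√(C * t) / H + 1) := by
      rw [h.integral_sq_stopped_sub h0 h1 ht0.le (n t)]
      refine mul_le_mul_of_nonneg_left ?_ hσ
      have hZm : MemLp (fun ω => H * (nu p t fun i => ξ i ω : ℝ) - t) 2 μ :=
        (hνm.const_mul H).sub (memLp_const t)
      have hi1 : Integrable (fun ω => |((nu p t fun i => ξ i ω : ℕ) : ℝ) - n t|) μ :=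
        ((hνm.sub (memLp_const (n t : ℝ))).integrable one_le_two).abs
      have hi2 : Integrable (fun ω => |H * (nu p t fun i => ξ i ω : ℝ) - t| / H + 1) μ :=
        ((hZm.integrable one_le_two).abs.div_const H).add (integrable_const 1)
      calc ∫ ω, |((nu p t fun i => ξ i ω : ℕ) : ℝ) - n t| ∂μ
          ≤ ∫ ω, (|H * (nu p t fun i => ξ i ω : ℝ) - t| / H + 1) ∂μ := by
            refine integral_mono hi1 hi2 fun ω => ?_
            have f1 := Nat.floor_le (show 0 ≤ H⁻¹ * t by positivity)
            have f2 := Nat.lt_floor_add_one (H⁻¹ * t)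
            have e : |H * (nu p t fun i => ξ i ω : ℝ) - t| / H =
                |(nu p t fun i => ξ i ω : ℝ) - H⁻¹ * t| := by
              rw [← abs_of_pos hH, ← abs_div, abs_of_pos hH]
              congr 1
              field_simp
            simp only [e]
            have e2 : |H⁻¹ * t - n t| ≤ 1 := by
              simp only [hn]
              rw [abs_le]
              constructor <;> linarith
            exact (abs_sub_le _ (H⁻¹ * t) _).trans (add_le_add le_rfl e2)
        _ = (∫ ω, |H * (nu p t fun i => ξ i ω : ℝ) - t| ∂μ) / H + 1 := by
            rw [integral_add ((hZm.integrable one_le_two).abs.div_const H) (integrable_const 1),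
              integral_div]
            simp
        _ ≤ √(C * t) / H + 1 := by
            gcongr
            exact (integral_abs_le_sqrt hZm).trans (Real.sqrt_le_sqrt (hC t ht))
    have hMM : ∫ ω, M ω ^ 2 ∂μ = sigmaSq p * n t := h.integral_sq_walk (n t)
    -- The mismatch of the two normalizations. The difference to be estimated is `B / (H √t) - (W -
    -- M) / (H √t) + θ M`; the factor 3 comes from `(x + y + z)² ≤ 3 (x² + y² + z²)`.
    set θ := κ * (√(n t))⁻¹ - 1 / (H * √t) with hθ
    have hpt : ∀ ω, (((nu p t fun i => ξ i ω) - t / H) / √t - -κ * ((√(n t))⁻¹ * M ω)) ^ 2 ≤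
        3 * (c ^ 2 / H ^ 2 * t⁻¹ + 1 / H ^ 2 * t⁻¹ * (W ω - M ω) ^ 2 + θ ^ 2 * M ω ^ 2) := by
      intro ω
      have e : ((nu p t fun i => ξ i ω) - t / H) / √t - -κ * ((√(n t))⁻¹ * M ω) =
          B ω / (H * √t) - (W ω - M ω) / (H * √t) + θ * M ω := by
        simp only [hθ, hB, hW]
        field_simp
        ring
      have e1 : (B ω / (H * √t)) ^ 2 ≤ c ^ 2 / H ^ 2 * t⁻¹ := by
        rw [div_pow, mul_pow, hst2, ← div_div, div_eq_mul_inv (_ / _)]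
        have := hBb ω
        gcongr
      have e2 : ((W ω - M ω) / (H * √t)) ^ 2 = 1 / H ^ 2 * t⁻¹ * (W ω - M ω) ^ 2 := by
        rw [div_pow, mul_pow, hst2]
        field_simp
      rw [e, ← e2, ← mul_pow]
      nlinarith [sq_nonneg (B ω / (H * √t) + (W ω - M ω) / (H * √t)),
        sq_nonneg (B ω / (H * √t) - θ * M ω), sq_nonneg ((W ω - M ω) / (H * √t) + θ * M ω)]
    have hDm : MemLp (fun ω => ((nu p t fun i => ξ i ω) - t / H) / √t -
        -κ * ((√(n t))⁻¹ * M ω)) 2 μ := by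
      have := ((hνm.sub (memLp_const (t / H))).mul_const (√t)⁻¹).sub
        ((hMm.const_mul (√(n t))⁻¹).const_mul (-κ))
      exact this
    have j1 : Integrable (fun ω => 1 / H ^ 2 * t⁻¹ * (W ω - M ω) ^ 2) μ :=
      (hWm.sub hMm).integrable_sq.const_mul _
    have j2 : Integrable (fun ω => θ ^ 2 * M ω ^ 2) μ := hMm.integrable_sq.const_mul _
    have j01 : Integrable (fun ω => c ^ 2 / H ^ 2 * t⁻¹ + 1 / H ^ 2 * t⁻¹ * (W ω - M ω) ^ 2) μ :=
      (integrable_const _).add j1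
    have hθn : θ ^ 2 * n t ≤ (κ - 1 / H * √(n t / t)) ^ 2 := by
      rcases Nat.eq_zero_or_pos (n t) with hz | hz
      · rw [hz]; simp only [Nat.cast_zero, mul_zero]; positivity
      · have hnp : (0 : ℝ) < n t := by exact_mod_cast hz
        have hsn : √(n t : ℝ) ^ 2 = n t := Real.sq_sqrt hnp.le
        have hsn0 : 0 < √(n t : ℝ) := Real.sqrt_pos.2 hnp
        refine le_of_eq ?_
        have : κ - 1 / H * √(n t / t) = θ * √(n t) := by
          rw [Real.sqrt_div hnp.le, hθ]
          field_simp
        rw [this, mul_pow, hsn]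
    calc _ ≤ ∫ ω, 3 * (c ^ 2 / H ^ 2 * t⁻¹ + 1 / H ^ 2 * t⁻¹ * (W ω - M ω) ^ 2 +
          θ ^ 2 * M ω ^ 2) ∂μ :=
          integral_mono hDm.integrable_sq ((j01.add j2).const_mul 3) hpt
      _ = 3 * (c ^ 2 / H ^ 2 * t⁻¹ + 1 / H ^ 2 * t⁻¹ * ∫ ω, (W ω - M ω) ^ 2 ∂μ +
          θ ^ 2 * (sigmaSq p * n t)) := by
          rw [integral_const_mul, integral_add j01 j2, integral_add (integrable_const _) j1,
            integral_const_mul, integral_const_mul, integral_const_mul, hMM]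
          simp
      _ ≤ 3 * (c ^ 2 / H ^ 2 * t⁻¹ + 1 / H ^ 2 * t⁻¹ * (sigmaSq p * (√(C * t) / H + 1)) +
          sigmaSq p * (κ - 1 / H * √(n t / t)) ^ 2) := by
          have := mul_le_mul_of_nonneg_left hθn hσ
          have e3 : θ ^ 2 * (sigmaSq p * n t) = sigmaSq p * (θ ^ 2 * n t) := by ring
          rw [e3]
          gcongr
      _ = _ := by
          have : t⁻¹ * √t = (√t)⁻¹ := by
            field_simp
            linarith
          rw [Real.sqrt_mul hC0, ← this]
          ring
  refine squeeze_zero' (Eventually.of_forall fun t => integral_nonneg fun ω => sq_nonneg _)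
    ((eventually_ge_atTop 1).mono hbound) ?_
  have l1 : Tendsto (fun t : ℝ => t⁻¹) atTop (𝓝 0) := tendsto_inv_atTop_zero
  have l2 : Tendsto (fun t : ℝ => (√t)⁻¹) atTop (𝓝 0) :=
    tendsto_inv_atTop_zero.comp Real.tendsto_sqrt_atTop
  have l3 : Tendsto (fun t : ℝ => (n t : ℝ) / t) atTop (𝓝 H⁻¹) :=
    tendsto_nat_floor_mul_div_atTop (by positivity)
  have := ((((l1.const_mul (c ^ 2 / H ^ 2)).add (((l2.const_mul (√C / H)).add l1).const_mul
    (sigmaSq p / H ^ 2))).add ((((l3.sqrt.const_mul (1 / H)).const_sub κ).pow 2).const_mul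
    (sigmaSq p)))).const_mul 3
  refine this.trans_eq ?_
  congr 1
  -- As `n / t → 1 / H`, the choice `κ = H^(-3/2)` is what removes the mismatch in the limit.
  have e : κ - 1 / H * √H⁻¹ = 0 := by
    rw [Real.sqrt_inv, hκ]
    field_simp
    ring
  rw [e]
  ring

/-- The central limit theorem for any process which agrees with the first passage time for large
thresholds. -/
theorem tendstoInDistribution_nu (h : IsBernoulliString p μ ξ) (h0 : 0 < p) (h1 : p < 1)
    {D : ℝ → Ω → ℝ} (hDm : ∀ R, Measurable (D R))
    (hD : ∀ R, 1 < R → ∀ ω, D R ω = nu p (Real.log R) fun i => ξ i ω)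
    {Ω' : Type*} [MeasurableSpace Ω'] {P : Measure Ω'} [IsProbabilityMeasure P] {Y : Ω' → ℝ}
    (hY : HasLaw Y (gaussianReal 0 (sigmaSq p).toNNReal) P) :
    TendstoInDistribution
      (fun (R : ℝ) ω => (D R ω - Real.log R / Real.binEntropy p) / √(Real.log R)) atTop
      (fun x => -(1 / (Real.binEntropy p * √(Real.binEntropy p))) * Y x) (fun _ => μ) P := by
  have hH := Real.binEntropy_pos h0 h1
  have hwalk := h.tendstoInDistribution_walk hY
  have hn : Tendsto (fun R : ℝ => ⌊(Real.binEntropy p)⁻¹ * Real.log R⌋₊) atTop atTop :=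
    tendsto_nat_floor_atTop.comp
      (Real.tendsto_log_atTop.const_mul_atTop (by positivity))
  have hwalk2 : TendstoInDistribution (fun (R : ℝ) ω =>
      (√⌊(Real.binEntropy p)⁻¹ * Real.log R⌋₊)⁻¹ *
        (partialSum p (fun i => ξ i ω) ⌊(Real.binEntropy p)⁻¹ * Real.log R⌋₊ -
          ⌊(Real.binEntropy p)⁻¹ * Real.log R⌋₊ * Real.binEntropy p)) atTop Y (fun _ => μ) P :=
    ⟨fun R => hwalk.forall_aemeasurable _, hwalk.aemeasurable_limit, hwalk.tendsto.comp hn⟩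
  have hwalk3 := hwalk2.continuous_comp
    (g := fun x => -(1 / (Real.binEntropy p * √(Real.binEntropy p))) * x) (by fun_prop)
  -- Slutsky's argument: the difference from the rescaled walk tends to zero in mean square, hence
  -- in measure.
  refine tendstoInDistribution_of_tendstoInMeasure_sub _ _ hwalk3 ?_
    fun R => (((hDm R).sub_const _).div_const _).aemeasurable
  refine tendstoInMeasure_zero_of_integral_sq ?_ ?_
  · filter_upwards [eventually_gt_atTop 1] with R hR
    have hm := h.memLp_nu h0 h1 (Real.log_nonneg hR.le) 2
    have := ((hm.sub (memLp_const (Real.log R / Real.binEntropy p))).mul_const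
      (√(Real.log R))⁻¹).sub (((h.memLp_walk ⌊(Real.binEntropy p)⁻¹ * Real.log R⌋₊ 2).const_mul
        (√⌊(Real.binEntropy p)⁻¹ * Real.log R⌋₊)⁻¹).const_mul
          (-(1 / (Real.binEntropy p * √(Real.binEntropy p)))))
    convert this using 1
    ext ω
    simp [hD R hR, div_eq_mul_inv]
  · refine ((h.tendsto_integral_sq_sub_walk h0 h1).comp Real.tendsto_log_atTop).congr' ?_
    filter_upwards [eventually_gt_atTop 1] with R hR
    refine integral_congr_ae (Eventually.of_forall fun ω => ?_)
    simp [hD R hR]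

theorem tendstoInDistribution_nu_gaussian (h : IsBernoulliString p μ ξ) (h0 : 0 < p) (h1 : p < 1)
    {D : ℝ → Ω → ℝ} (hDm : ∀ R, Measurable (D R))
    (hD : ∀ R, 1 < R → ∀ ω, D R ω = nu p (Real.log R) fun i => ξ i ω) :
    TendstoInDistribution
      (fun (R : ℝ) ω => (D R ω - Real.log R / Real.binEntropy p) / √(Real.log R)) atTop
      (id : ℝ → ℝ) (fun _ => μ)
      (gaussianReal 0 (sigmaSq p / Real.binEntropy p ^ 3).toNNReal) := by
  have hH := Real.binEntropy_pos h0 h1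
  have hσ := sigmaSq_nonneg h0 h1
  have hsH := Real.sq_sqrt hH.le
  have hsH0 := Real.sqrt_pos.2 hH
  -- The limit is `-H^(-3/2) Y`. Taking `Y = -H^(3/2) id` makes it the identity and gives `Y` the
  -- variance `σ²`; this includes `σ² = 0`.
  have hY := gaussianReal_const_mul
    (HasLaw.id (μ := gaussianReal 0 (sigmaSq p / Real.binEntropy p ^ 3).toNNReal))
    (-(Real.binEntropy p * √(Real.binEntropy p)))
  have e : NNReal.mk ((-(Real.binEntropy p * √(Real.binEntropy p))) ^ 2) (sq_nonneg _) *
      (sigmaSq p / Real.binEntropy p ^ 3).toNNReal = (sigmaSq p).toNNReal := by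
    ext
    rw [NNReal.coe_mul, Real.coe_toNNReal _ (by positivity), Real.coe_toNNReal _ hσ, NNReal.coe_mk,
      neg_sq, mul_pow, hsH]
    field_simp
  rw [mul_zero, e] at hY
  convert h.tendstoInDistribution_nu h0 h1 hDm hD hY using 1
  ext x
  simp only [id]
  field_simp

theorem tendstoInDistribution_nu_standard (h : IsBernoulliString p μ ξ) (h0 : 0 < p) (h1 : p < 1)
    (hp : p ≠ 1 / 2) {D : ℝ → Ω → ℝ} (hDm : ∀ R, Measurable (D R))
    (hD : ∀ R, 1 < R → ∀ ω, D R ω = nu p (Real.log R) fun i => ξ i ω) :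
    TendstoInDistribution
      (fun (R : ℝ) ω => (D R ω - Real.log R / Real.binEntropy p) /
        √(sigmaSq p / Real.binEntropy p ^ 3 * Real.log R)) atTop
      (id : ℝ → ℝ) (fun _ => μ) (gaussianReal 0 1) := by
  have hH := Real.binEntropy_pos h0 h1
  have hσ := sigmaSq_pos h0 h1 hp
  have hsσ := Real.sq_sqrt hσ.le
  have hsσ0 := Real.sqrt_pos.2 hσ
  have hsH0 := Real.sqrt_pos.2 hH
  have hY := gaussianReal_const_mul (HasLaw.id (μ := gaussianReal 0 1)) (-√(sigmaSq p))
  have e : NNReal.mk ((-√(sigmaSq p)) ^ 2) (sq_nonneg _) * 1 = (sigmaSq p).toNNReal := by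
    ext
    rw [NNReal.coe_mul, Real.coe_toNNReal _ hσ.le, NNReal.coe_mk, neg_sq, hsσ]
    simp
  rw [mul_zero, e] at hY
  have := (h.tendstoInDistribution_nu h0 h1 hDm hD hY).continuous_comp
    (g := fun x => x / √(sigmaSq p / Real.binEntropy p ^ 3)) (by fun_prop)
  have hs3 : √(Real.binEntropy p ^ 3) = Real.binEntropy p * √(Real.binEntropy p) := by
    rw [pow_succ, Real.sqrt_mul (by positivity), Real.sqrt_sq hH.le]
  convert this using 1
  · ext R ω
    rw [Function.comp, Real.sqrt_mul (by positivity), div_div, mul_comm (√(Real.log R))]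
  · ext x
    simp only [Function.comp, id, Real.sqrt_div hσ.le, hs3]
    field_simp

end IsBernoulliString

end Khodak

/-! ### Assembly of the results under `t = log R` -/

theorem mainTheorem12 (p : ℝ) (hp0 : 0 < p) (hp1 : p < 1) :
    -- the number of phrases
    ((¬ (∃ c : ℚ, (c : ℝ) = Real.log p / Real.log (1 - p)) →
        Tendsto (fun R : ℝ => (Khodak.numPhrases p R : ℝ) / R) atTop
          (𝓝 (1 / Real.binEntropy p))) ∧
      ((∃ c : ℚ, (c : ℝ) = Real.log p / Real.log (1 - p)) →
        ∀ d : ℝ, d = Khodak.realGcd (Real.log p) (Real.log (1 - p)) →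
          Tendsto (fun R : ℝ => (Khodak.numPhrases p R : ℝ) / R -
              1 / Real.binEntropy p * (d / (1 - Real.exp (-d))) *
                Real.exp (-d * Int.fract (Real.log R / d))) atTop (𝓝 0))) ∧
    -- the length of a random phrase, for a string of i.i.d. Bernoulli letters
    (∀ {Ω : Type*} [MeasurableSpace Ω] (μ : Measure Ω) [IsProbabilityMeasure μ]
        (ξ : ℕ → Ω → Bool), (∀ i, Measurable (ξ i)) → iIndepFun ξ μ →
        (∀ i, μ.real {ω | ξ i ω = true} = p) →
      ∀ D : ℝ → Ω → ℝ, (∀ R ω, D R ω = Khodak.phraseLength p R (fun i => ξ i ω)) →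
        -- the phrase length is a first passage time with finite moments
        (∀ R : ℝ, 1 < R → ∀ ω,
          Khodak.phraseLength p R (fun i => ξ i ω) =
            Khodak.nu p (Real.log R) (fun i => ξ i ω)) ∧
        (∀ R : ℝ, 1 < R → MemLp (D R) 2 μ) ∧
        -- strong law of large numbers
        (∀ᵐ ω ∂μ, Tendsto (fun R : ℝ => D R ω / Real.log R) atTop
          (𝓝 (1 / Real.binEntropy p))) ∧
        -- central limit theorem, in the form that also covers zero variance
        TendstoInDistribution
          (fun (R : ℝ) ω => (D R ω - Real.log R / Real.binEntropy p) / √(Real.log R)) atTop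
          (id : ℝ → ℝ) (fun _ => μ)
          (gaussianReal 0 (Khodak.sigmaSq p / Real.binEntropy p ^ 3).toNNReal) ∧
        -- central limit theorem, normalized
        (p ≠ 1 / 2 → 0 < Khodak.sigmaSq p ∧
          TendstoInDistribution
            (fun (R : ℝ) ω => (D R ω - Real.log R / Real.binEntropy p) /
              √(Khodak.sigmaSq p / Real.binEntropy p ^ 3 * Real.log R)) atTop
            (id : ℝ → ℝ) (fun _ => μ) (gaussianReal 0 1)) ∧
        -- variance
        Khodak.sigmaSq p = p * (1 - p) * Real.log (p / (1 - p)) ^ 2 ∧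
        ((fun R : ℝ => Var[D R; μ]) ~[atTop]
          fun R => Khodak.sigmaSq p / Real.binEntropy p ^ 3 * Real.log R) ∧
        -- mean
        (¬ (∃ c : ℚ, (c : ℝ) = Real.log p / Real.log (1 - p)) →
          Tendsto (fun R : ℝ => (∫ ω, D R ω ∂μ) -
              (Real.log R / Real.binEntropy p +
                Khodak.secondMoment p / (2 * Real.binEntropy p ^ 2))) atTop (𝓝 0)) ∧
        ((∃ c : ℚ, (c : ℝ) = Real.log p / Real.log (1 - p)) →
          ∀ d : ℝ, d = Khodak.realGcd (Real.log p) (Real.log (1 - p)) →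
            Tendsto (fun R : ℝ => (∫ ω, D R ω ∂μ) -
                (Real.log R / Real.binEntropy p +
                  Khodak.secondMoment p / (2 * Real.binEntropy p ^ 2) +
                  d / Real.binEntropy p * (1 / 2 - Int.fract (Real.log R / d))))
              atTop (𝓝 0))) := by
  have hlog : Tendsto Real.log atTop atTop := Real.tendsto_log_atTop
  have hnum : ∀ R : ℝ, 1 < R → (Khodak.numPhrases p R : ℝ) / R =
      Real.exp (-Real.log R) * Khodak.leafCount p (Real.log R) := by
    intro R hR
    rw [Khodak.numPhrases_eq_leafCount hp0 hp1 hR.le, Real.exp_neg, Real.exp_log (by linarith),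
      div_eq_mul_inv, mul_comm]
  refine ⟨⟨fun hirr => ?_, fun hrat d hd => ?_⟩, ?_⟩
  · refine ((Khodak.tendsto_leafCount_of_irrational hp0 hp1 hirr).comp hlog).congr' ?_
    filter_upwards [eventually_gt_atTop 1] with R hR
    rw [hnum R hR, Function.comp]
  · obtain ⟨hd0, m, n, hmn, ha, hb⟩ := Khodak.exists_coprime_of_realGcd hp0 hp1 hrat
    rw [← hd] at hd0 ha hb
    refine ((Khodak.tendsto_leafCount_of_lattice hp0 hp1 hd0 ha hb hmn).comp hlog).congr' ?_
    filter_upwards [eventually_gt_atTop 1] with R hR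
    rw [hnum R hR, Function.comp]
  intro Ω _ μ _ ξ hmeas hindep hprob D hD
  have h : Khodak.IsBernoulliString p μ ξ := ⟨hmeas, hindep, hprob⟩
  have hnu : ∀ R : ℝ, 1 < R → ∀ ω, D R ω = Khodak.nu p (Real.log R) fun i => ξ i ω := by
    intro R hR ω
    rw [hD, Khodak.phraseLength_eq_nu hp0 hp1 hR.le]
  have hDfun : ∀ R : ℝ, D R = fun ω => (Khodak.phraseLength p R fun i => ξ i ω : ℝ) :=
    fun R => funext (hD R)
  have hDnu : ∀ R : ℝ, 1 < R →
      D R = fun ω => (Khodak.nu p (Real.log R) fun i => ξ i ω : ℝ) :=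
    fun R hR => funext (hnu R hR)
  have hDm : ∀ R, Measurable (D R) := fun R => by
    rw [hDfun]
    exact measurable_from_nat.comp (h.measurable_phraseLength R)
  have hint : ∀ R : ℝ, 1 < R → ∫ ω, D R ω ∂μ = Khodak.meanDepth p (Real.log R) := by
    intro R hR
    rw [hDnu R hR]
    exact h.integral_nu hp0 hp1 _
  refine ⟨fun R hR ω => Khodak.phraseLength_eq_nu hp0 hp1 hR.le _, fun R hR => ?_, ?_,
    h.tendstoInDistribution_nu_gaussian hp0 hp1 hDm hnu,
    fun hp => ⟨Khodak.sigmaSq_pos hp0 hp1 hp,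
      h.tendstoInDistribution_nu_standard hp0 hp1 hp hDm hnu⟩,
    Khodak.sigmaSq_eq hp0 hp1, ?_, fun hirr => ?_, fun hrat d hd => ?_⟩
  · rw [hDnu R hR]
    exact h.memLp_nu hp0 hp1 (Real.log_nonneg hR.le) 2
  · filter_upwards [h.ae_tendsto_nu_div hp0 hp1] with ω hω
    refine (hω.comp hlog).congr' ?_
    filter_upwards [eventually_gt_atTop 1] with R hR
    rw [hnu R hR, Function.comp]
  · refine ((h.isEquivalent_variance_nu hp0 hp1).comp_tendsto hlog).congr_left ?_
    filter_upwards [eventually_gt_atTop 1] with R hR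
    rw [hDnu R hR, Function.comp]
  · refine ((Khodak.tendsto_meanDepth_of_irrational hp0 hp1 hirr).comp hlog).congr' ?_
    filter_upwards [eventually_gt_atTop 1] with R hR
    rw [hint R hR, Function.comp]
  · obtain ⟨hd0, m, n, hmn, ha, hb⟩ := Khodak.exists_coprime_of_realGcd hp0 hp1 hrat
    rw [← hd] at hd0 ha hb
    refine ((Khodak.tendsto_meanDepth_of_lattice hp0 hp1 hd0 ha hb hmn).comp hlog).congr' ?_
    filter_upwards [eventually_gt_atTop 1] with R hR
    rw [hint R hR, Function.comp]
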